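/- There is an absolute constant $C>0$ such that the following holds. Let $K,n,p_1,\dots,p_K\ge 1$ be integers and $p=\sum_k p_k$. A real random variable $z$ is called sub-gaussian if $\mathbb{E}[e^{z^2/L^2}]\le 2$ for some $L>0$; the infimum of such $L$ is its sub-gaussian norm $\|z\|_{\psi_2}$; and $z\sim\mathcal{S}(1)$ means that $z$ is sub-gaussian with mean zero and variance one. For each $k=1,\dots,K$ let $A_k=Z_k\Lambda_k^{1/2}U_k^{\mathrm T}\in\mathbb{R}^{n\times p_k}$, where the entries of the random matrix $Z_k\in\mathbb{R}^{n\times p_k}$ are i.i.d. with a distribution $\mathcal{S}(1)$ (which may depend on $k$), $\Lambda_k\in\mathbb{R}^{p_k\times p_k}$ is diagonal and positive definite, and $U_k\in\mathbb{R}^{p_k\times p_k}$ is orthogonal; $Z_1,\dots,Z_K$ are independent. Let $\Sigma_k$ be the covariance matrix of the rows of $A_k$ (the covariance matrix of the rows of $A=[A_1,\dots,A_K]$ is then block-diagonal). Let $$B=I_p-\frac1K\bar A A,\qquad \bar A=\begin{bmatrix}A_1^+\\ \vdots\\ A_K^+\end{bmatrix},$$ where $A_k^+$ is the Moore–Penrose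 pseudoinverse. Let $q_k,\bar q_k\ge 0$, and let $L_k\ge 1$ be constants such that, for every $h\in\mathbb{R}^{p_k}$ and every row $a^{\mathrm T}$ of $A_k$, $\|h^{\mathrm T}a\|_{\psi_2}\le L_k\sqrt{h^{\mathrm T}\Sigma_k h}$. Let $\sigma_{\max},\sigma_{\min}$ denote the largest and smallest singular values, $(x)_+=\max\{0,x\}$, $(x)_+^2=((x)_+)^2$, and define $$\ell_k(q_k)=C L_k^2\left(\sqrt{\frac{p_k+q_k}{n}}+\frac{p_k+q_k}{n}\right) n\,\sigma_{\max}(\Sigma_k),$$ $$\eta_k=\begin{cases}\big(n\,\sigma_{\min}(\Sigma_k)-\ell_k(q_k)\big)_+, & n\ge p_k,\\[2pt] \sigma_{\min}(\Sigma_k)\,\big(\sqrt{p_k}-C L_k^2(\sqrt n+\bar q_k)\big)_+^2, & n<p_k,\end{cases}$$ $$\beta_S=1+\frac1K\sqrt{K+\sum_{k=1}^K\ \sum_{\substack{i=1\\ i\ne k}}^K\frac{n\,\sigma_{\max}(\Sigma_k)+\ell_k(q_k)}{\eta_i}}\ \in[0,\infty],$$ with the convention $a/0=+\infty$ for $a>0$.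 Then the spectral norm of $B$ satisfies $$\|B\|\le\beta_S$$ with probability at least $$1-\sum_{k=1}^K 2e^{-q_k}-\sum_{k:\,p_k>n}2e^{-\bar q_k^2}.$$ -/

import Mathlib

noncomputable section

namespace PartitionedLS

open MeasureTheory ProbabilityTheory

/-! ### Moore–Penrose pseudoinverse -/

/-- The four Penrose equations for a real matrix `A` and a candidate pseudoinverse `X`. -/
structure IsMoorePenrose {m n : Type*} [Fintype m] [Fintype n]
    (A : Matrix m n ℝ) (X : Matrix n m ℝ) : Prop where
  mul_mul_self : A * X * A = A
  self_mul_mul : X * A * X = X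
  symm_left : (A * X).transpose = A * X
  symm_right : (X * A).transpose = X * A

theorem exists_isMoorePenrose {m n : Type*} [Fintype m] [Fintype n]
    (A : Matrix m n ℝ) : ∃ X : Matrix n m ℝ, IsMoorePenrose A X := by
  classical
  have hH : (A.transpose * A).IsHermitian := by
    simpa using Matrix.isHermitian_conjTranspose_mul_self A
  set U : Matrix n n ℝ := (hH.eigenvectorUnitary : Matrix n n ℝ) with hU
  set d : n → ℝ := hH.eigenvalues with hd
  have hUU : U.transpose * U = 1 := by
    have := Unitary.coe_star_mul_self hH.eigenvectorUnitary
    simpa [Matrix.star_eq_conjTranspose, hU] using this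
  have hHd : A.transpose * A = U * Matrix.diagonal d * U.transpose := by
    have h := hH.spectral_theorem
    rw [Unitary.conjStarAlgAut_apply] at h
    simpa [Matrix.star_eq_conjTranspose, hU, hd, Function.comp_def] using h
  set G : Matrix n n ℝ := U * Matrix.diagonal (fun i => (d i)⁻¹) * U.transpose with hG
  have key : ∀ a b : n → ℝ, (U * Matrix.diagonal a * U.transpose) *
      (U * Matrix.diagonal b * U.transpose)
        = U * Matrix.diagonal (fun i => a i * b i) * U.transpose := by
    intro a b
    calc _ = U * Matrix.diagonal a * (U.transpose * U) * Matrix.diagonal b * U.transpose := by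
          simp only [Matrix.mul_assoc]
      _ = _ := by
          rw [hUU, Matrix.mul_one, Matrix.mul_assoc U, Matrix.diagonal_mul_diagonal]
  have hsymm : ∀ a : n → ℝ, (U * Matrix.diagonal a * U.transpose).transpose
      = U * Matrix.diagonal a * U.transpose := by
    intro a
    simp [Matrix.transpose_mul, Matrix.mul_assoc]
  have hGT : G.transpose = G := hsymm _
  have hGH : G * (A.transpose * A)
      = U * Matrix.diagonal (fun i => (d i)⁻¹ * d i) * U.transpose := by
    rw [hHd, hG, key]
  have hHGH : (A.transpose * A) * (G * (A.transpose * A)) = A.transpose * A := by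
    rw [hGH, hHd, key]
    congr 3
    funext i
    by_cases h : d i = 0 <;> simp [h]
  have hGHG : G * (A.transpose * A) * G = G := by
    rw [hGH, hG, key]
    congr 3
    funext i
    by_cases h : d i = 0 <;> simp [h]
  have hGHT : (G * (A.transpose * A)).transpose = G * (A.transpose * A) := by
    rw [hGH]; exact hsymm _
  have hA : A * (G * (A.transpose * A)) = A := by
    have h0 : (A * (G * (A.transpose * A)) - A).transpose * (A * (G * (A.transpose * A)) - A)
        = 0 := by
      have hl : A.transpose * (A * (G * (A.transpose * A)) - A) = 0 := by
        rw [Matrix.mul_sub, ← Matrix.mul_assoc, hHGH, sub_self]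
      have ht : (A * (G * (A.transpose * A)) - A).transpose
          = G * (A.transpose * A) * A.transpose - A.transpose := by
        rw [Matrix.transpose_sub, Matrix.transpose_mul, hGHT]
      rw [ht, Matrix.sub_mul, Matrix.mul_assoc (G * _), hl, Matrix.mul_zero, sub_self]
    have := Matrix.conjTranspose_mul_self_eq_zero
      (A := A * (G * (A.transpose * A)) - A)
    rw [Matrix.conjTranspose_eq_transpose_of_trivial] at this
    exact sub_eq_zero.mp (this.mp h0)
  refine ⟨G * A.transpose, ?_, ?_, ?_, ?_⟩
  · simpa only [Matrix.mul_assoc] using hA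
  · calc G * A.transpose * A * (G * A.transpose)
        = G * (A.transpose * A) * G * A.transpose := by simp only [Matrix.mul_assoc]
      _ = _ := by rw [hGHG]
  · calc (A * (G * A.transpose)).transpose
        = A * G.transpose * A.transpose := by
          rw [Matrix.transpose_mul, Matrix.transpose_mul, Matrix.transpose_transpose]
      _ = A * (G * A.transpose) := by rw [hGT, Matrix.mul_assoc]
  · rw [Matrix.mul_assoc]; exact hGHT

/-- The Moore–Penrose pseudoinverse `A⁺`. -/
def pinv {m n : Type*} [Fintype m] [Fintype n] (A : Matrix m n ℝ) : Matrix n m ℝ :=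
  Classical.choose (exists_isMoorePenrose A)

theorem isMoorePenrose_pinv {m n : Type*} [Fintype m] [Fintype n]
    (A : Matrix m n ℝ) : IsMoorePenrose A (pinv A) :=
  Classical.choose_spec (exists_isMoorePenrose A)

theorem IsMoorePenrose.eq_pinv {m n : Type*} [Fintype m] [Fintype n]
    {A : Matrix m n ℝ} {X : Matrix n m ℝ} (hX : IsMoorePenrose A X) : X = pinv A := by
  have hY := isMoorePenrose_pinv A
  set Y := pinv A
  have h1 : A * X = A * Y := by
    calc A * X = (A * X).transpose := hX.symm_left.symm
      _ = (A * Y * (A * X)).transpose := by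
          rw [← Matrix.mul_assoc, hY.mul_mul_self]
      _ = A * X * (A * Y) := by rw [Matrix.transpose_mul, hX.symm_left, hY.symm_left]
      _ = A * Y := by rw [← Matrix.mul_assoc, hX.mul_mul_self]
  have h2 : X * A = Y * A := by
    calc X * A = (X * A).transpose := hX.symm_right.symm
      _ = (X * A * (Y * A)).transpose := by
          rw [Matrix.mul_assoc X, ← Matrix.mul_assoc A, hY.mul_mul_self]
      _ = Y * A * (X * A) := by rw [Matrix.transpose_mul, hX.symm_right, hY.symm_right]
      _ = Y * A := by rw [Matrix.mul_assoc Y, ← Matrix.mul_assoc A, hX.mul_mul_self]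
  calc X = X * A * X := hX.self_mul_mul.symm
    _ = Y * A * X := by rw [h2]
    _ = Y * A * Y := by rw [Matrix.mul_assoc, h1, Matrix.mul_assoc]
    _ = Y := hY.self_mul_mul

/-! ### Spectral norm and extreme singular values -/

/-- Spectral norm of a square real matrix: operator norm for the Euclidean norm. -/
def spectralNorm {ι : Type*} [Fintype ι] [DecidableEq ι] (M : Matrix ι ι ℝ) : ℝ :=
  ‖Matrix.toEuclideanCLM (𝕜 := ℝ) M‖

/-- Largest singular value (singular values are listed in decreasing order, from index `0`). -/
def sigmaMax {m p : ℕ} (M : Matrix (Fin m) (Fin p) ℝ) : ℝ :=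
  (Matrix.toEuclideanLin M).singularValues 0

/-- Smallest of the `min m p` singular values of an `m × p` matrix. -/
def sigmaMin {m p : ℕ} (M : Matrix (Fin m) (Fin p) ℝ) : ℝ :=
  (Matrix.toEuclideanLin M).singularValues (min m p - 1)

/-! ### Column-partitioned matrices -/

/-- `A = [A₁, …, A_K]`, with columns indexed by pairs (block, column inside the block). -/
def hcat {K n : ℕ} {p : Fin K → ℕ} (A : ∀ k, Matrix (Fin n) (Fin (p k)) ℝ) :
    Matrix (Fin n) (Σ k, Fin (p k)) ℝ :=
  Matrix.of fun i x => A x.1 i x.2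

/-- `Ā = [A₁⁺; …; A_K⁺]`, the pseudoinverses of the blocks stacked on top of each other. -/
def stackedPinv {K n : ℕ} {p : Fin K → ℕ} (A : ∀ k, Matrix (Fin n) (Fin (p k)) ℝ) :
    Matrix (Σ k, Fin (p k)) (Fin n) ℝ :=
  Matrix.of fun x i => pinv (A x.1) x.2 i

/-- `B = I_p - (1/K) Ā A`. -/
def iterMatrix {K n : ℕ} {p : Fin K → ℕ} (A : ∀ k, Matrix (Fin n) (Fin (p k)) ℝ) :
    Matrix (Σ k, Fin (p k)) (Σ k, Fin (p k)) ℝ :=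
  1 - (1 / (K : ℝ)) • (stackedPinv A * hcat A)

/-- The block `Z Λ^{1/2} Uᵀ` for `Λ = diag(lam)`. -/
def colouredBlock {n p : ℕ} (Z : Matrix (Fin n) (Fin p) ℝ) (lam : Fin p → ℝ)
    (U : Matrix (Fin p) (Fin p) ℝ) : Matrix (Fin n) (Fin p) ℝ :=
  Z * Matrix.diagonal (fun j => √(lam j)) * U.transpose

/-! ### Sub-gaussian random variables -/

/-- `E[exp(z² / L²)] ≤ 2`; the expectation is a Lebesgue integral with values in `[0, ∞]`. -/
def SubgaussianBound {Ω : Type*} [MeasurableSpace Ω] (z : Ω → ℝ) (μ : Measure Ω) (L : ℝ) : Prop :=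
  ∫⁻ ω, ENNReal.ofReal (Real.exp (z ω ^ 2 / L ^ 2)) ∂μ ≤ 2

/-- Sub-gaussian random variable. -/
def IsSubgaussian {Ω : Type*} [MeasurableSpace Ω] (z : Ω → ℝ) (μ : Measure Ω) : Prop :=
  ∃ L : ℝ, 0 < L ∧ SubgaussianBound z μ L

/-- The sub-gaussian norm `‖z‖_{ψ₂}` of a sub-gaussian random variable `z`. -/
def psi2Norm {Ω : Type*} [MeasurableSpace Ω] (z : Ω → ℝ) (μ : Measure Ω) : ℝ :=
  sInf {L : ℝ | 0 < L ∧ SubgaussianBound z μ L}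

/-- `z ∼ S(1)`: a sub-gaussian random variable with mean zero and variance one. -/
structure IsStdSubgaussian {Ω : Type*} [MeasurableSpace Ω] (z : Ω → ℝ) (μ : Measure Ω) :
    Prop where
  measurable : Measurable z
  subgaussian : IsSubgaussian z μ
  mean_zero : ∫ ω, z ω ∂μ = 0
  variance_one : variance z μ = 1

/-! ### The explicit bound -/

/-- `ℓ = C L² (√((p+q)/n) + (p+q)/n) · n σ_max(Σ)`. -/
def ell (C L q : ℝ) (n : ℕ) {p : ℕ} (Sig : Matrix (Fin p) (Fin p) ℝ) : ℝ :=
  C * L ^ 2 * (√((p + q) / n) + (p + q) / n) * (n * sigmaMax Sig)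

/-- `η`: `(n σ_min(Σ) - ℓ)₊` if `n ≥ p`, and `σ_min(Σ) (√p - C L² (√n + q̄))₊²` if `n < p`. -/
def eta (C L q qbar : ℝ) (n : ℕ) {p : ℕ} (Sig : Matrix (Fin p) (Fin p) ℝ) : ℝ :=
  if p ≤ n then max 0 (n * sigmaMin Sig - ell C L q n Sig)
  else sigmaMin Sig * (max 0 (√p - C * L ^ 2 * (√n + qbar))) ^ 2

/-- `β_S`, with values in `[0, ∞]`: it is infinite as soon as `K ≥ 2` and some `η` vanishes
(in `ℝ≥0∞`, `a / 0 = ∞` for `a ≠ 0`). -/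
def betaS {K : ℕ} (n : ℕ) {p : Fin K → ℕ} (Sig : ∀ k, Matrix (Fin (p k)) (Fin (p k)) ℝ)
    (C : ℝ) (L q qbar : Fin K → ℝ) : ENNReal :=
  1 + ENNReal.ofReal (1 / K) *
    ((K : ENNReal) + ∑ k, ∑ i ∈ Finset.univ.filter (fun i => i ≠ k),
      ENNReal.ofReal (n * sigmaMax (Sig k) + ell C (L k) (q k) n (Sig k)) /
        ENNReal.ofReal (eta C (L i) (q i) (qbar i) n (Sig i))) ^ (1 / 2 : ℝ)

end PartitionedLS

end

namespace PartitionedLS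
open MeasureTheory ProbabilityTheory

/-! Deterministic part: `‖B‖ ≤ 1 + ‖ĀA‖ / K`, and the `(i, k)` block of `ĀA` is `Aᵢ⁺ Aₖ`. Diagonal
blocks are orthogonal projections, contributing at most 1 each; off the diagonal `‖Aᵢ⁺ Aₖ‖² ≤ ‖Aᵢ⁺‖²
‖Aₖ‖²`. Cauchy–Schwarz over the blocks (`spectralNorm_iterMatrix_le`) bounds `‖ĀA‖²` by the sum of
these squared bounds. It remains to prove `‖Aₖ‖² ≤ n σ_max + ℓₖ` and `ηᵢ ‖Aᵢ⁺‖² ≤ 1` off a small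
event.

Both follow from uniform concentration of `‖Zx‖²` around `n‖x‖²`
(`measure_exists_mulVec_sq_deviation_le`): a Bernstein bound for each fixed unit vector, then a
union bound over a `1/2`-net of at most `5^p` points. For `n < p` the same estimate is applied to
`Zᵀ`, with `q̄²` in the role of `q`, and turned into a bound on `A⁺` by
`pinv_mulVec_le_of_transpose_lower_bound`. The sub-gaussian norm of the entries is controlled by
`L`, because each entry of `Z` is a normalised linear functional of a row of `A`. -/

/-! ### Moment generating functions of sub-gaussian variables and their squares -/

theorem exp_le_self_add_exp_sq (x : ℝ) : Real.exp x ≤ x + Real.exp (x ^ 2) := by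
  have h2 := Real.add_one_le_exp (x ^ 2)
  rcases le_or_gt |x| 1 with h | h
  · have := (abs_le.1 (Real.abs_exp_sub_one_sub_id_le h)).2
    linarith
  · rcases lt_abs.1 h with h | h
    · have : Real.exp x ≤ Real.exp (x ^ 2) := Real.exp_le_exp.2 (by nlinarith)
      linarith
    · have : Real.exp x ≤ 1 := Real.exp_le_one_iff.2 (by linarith)
      nlinarith

theorem exp_le_one_add_self_add_sq_mul_exp_abs (u : ℝ) :
    Real.exp u ≤ 1 + u + u ^ 2 * Real.exp |u| := by
  have h1 : 1 ≤ Real.exp |u| := Real.one_le_exp (abs_nonneg u)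
  rcases le_or_gt |u| 1 with h | h
  · have := (abs_le.1 (Real.abs_exp_sub_one_sub_id_le h)).2
    nlinarith [sq_nonneg u]
  · rcases lt_abs.1 h with h | h
    · rw [abs_of_pos (by linarith)] at *
      have : 1 ≤ u ^ 2 := by nlinarith
      nlinarith [Real.exp_pos u]
    · have : Real.exp u ≤ 1 := Real.exp_le_one_iff.2 (by linarith)
      nlinarith [sq_nonneg u]

/-- Convexity of `exp` between `0` and `u`. It improves `E exp u ≤ 2` to `E exp (s u) ≤ 1 + s`,
which tends to 1 with `s`. -/
theorem exp_mul_le_one_add_mul {s : ℝ} (h0 : 0 ≤ s) (h1 : s ≤ 1) (u : ℝ) :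
    Real.exp (s * u) ≤ 1 + s * (Real.exp u - 1) := by
  have := convexOn_exp.2 (Set.mem_univ u) (Set.mem_univ 0) h0 (sub_nonneg.2 h1) (by ring)
  simp only [smul_eq_mul, mul_zero, add_zero, Real.exp_zero, mul_one] at this
  linarith

section
variable {Ω : Type*} [MeasurableSpace Ω] {μ : Measure Ω}

theorem SubgaussianBound.mono {z : Ω → ℝ} {L L' : ℝ} (h : SubgaussianBound z μ L)
    (hL : 0 < L) (hLL' : L ≤ L') : SubgaussianBound z μ L' := by
  refine le_trans (lintegral_mono fun ω => ENNReal.ofReal_le_ofReal (Real.exp_le_exp.2 ?_)) h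
  gcongr

theorem integrable_exp_of_lintegral_le {f : Ω → ℝ} (hf : Measurable f) {b : ℝ} (hb : 0 ≤ b)
    (h : ∫⁻ ω, ENNReal.ofReal (Real.exp (f ω)) ∂μ ≤ ENNReal.ofReal b) :
    Integrable (fun ω => Real.exp (f ω)) μ ∧ ∫ ω, Real.exp (f ω) ∂μ ≤ b := by
  have hae : AEStronglyMeasurable (fun ω => Real.exp (f ω)) μ :=
    (Real.measurable_exp.comp hf).aestronglyMeasurable
  refine ⟨⟨hae, ?_⟩, ?_⟩
  · rw [hasFiniteIntegral_iff_ofReal (ae_of_all _ fun ω => (Real.exp_pos _).le)]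
    exact h.trans_lt ENNReal.ofReal_lt_top
  · rw [integral_eq_lintegral_of_nonneg_ae (ae_of_all _ fun ω => (Real.exp_pos _).le) hae]
    exact ENNReal.toReal_le_of_le_ofReal hb h

theorem SubgaussianBound.hasSubgaussianMGF [IsProbabilityMeasure μ] {z : Ω → ℝ} {L : ℝ}
    (h : SubgaussianBound z μ L) (hL : 0 < L) (hz : Measurable z) (h0 : ∫ ω, z ω ∂μ = 0) :
    HasSubgaussianMGF z (2 * L ^ 2).toNNReal μ := by
  obtain ⟨hW, hW2⟩ := integrable_exp_of_lintegral_le (μ := μ) (f := fun ω => z ω ^ 2 / L ^ 2)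
    (by fun_prop) (b := 2) (by norm_num) (by simpa [SubgaussianBound] using h)
  have hyoung : ∀ t ω, t * z ω ≤ t ^ 2 * L ^ 2 / 2 + 1 / 2 * (z ω ^ 2 / L ^ 2) := by
    intro t ω
    have : 0 ≤ (t * L - z ω / L) ^ 2 := sq_nonneg _
    have e : (t * L - z ω / L) ^ 2 = t ^ 2 * L ^ 2 - 2 * (t * z ω) + z ω ^ 2 / L ^ 2 := by
      field_simp
      ring
    linarith
  have hdom : ∀ s : ℝ, 0 ≤ s → s ≤ 1 →
      Integrable (fun ω => Real.exp (s * (z ω ^ 2 / L ^ 2))) μ ∧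
        ∫ ω, Real.exp (s * (z ω ^ 2 / L ^ 2)) ∂μ ≤ 1 + s := by
    intro s hs0 hs1
    have hsub : Integrable (fun ω => s * (Real.exp (z ω ^ 2 / L ^ 2) - 1)) μ :=
      (hW.sub (integrable_const _)).const_mul _
    have hb : Integrable (fun ω => 1 + s * (Real.exp (z ω ^ 2 / L ^ 2) - 1)) μ :=
      (integrable_const _).add hsub
    have hi : Integrable (fun ω => Real.exp (s * (z ω ^ 2 / L ^ 2))) μ := by
      refine hb.mono' (by fun_prop) (ae_of_all _ fun ω => ?_)
      rw [Real.norm_eq_abs, abs_of_pos (Real.exp_pos _)]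
      exact exp_mul_le_one_add_mul hs0 hs1 _
    refine ⟨hi, (integral_mono hi hb fun ω => exp_mul_le_one_add_mul hs0 hs1 _).trans ?_⟩
    rw [integral_add (integrable_const _) hsub, integral_const_mul,
      integral_sub hW (integrable_const _)]
    simp only [integral_const, probReal_univ, smul_eq_mul, mul_one]
    nlinarith
  obtain ⟨hhalf, hhalf'⟩ := hdom (1 / 2) (by norm_num) (by norm_num)
  have hint : ∀ t : ℝ, Integrable (fun ω => Real.exp (t * z ω)) μ := by
    intro t
    refine (hhalf.const_mul (Real.exp (t ^ 2 * L ^ 2 / 2))).mono' (by fun_prop)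
      (ae_of_all _ fun ω => ?_)
    rw [Real.norm_eq_abs, abs_of_pos (Real.exp_pos _), ← Real.exp_add]
    exact Real.exp_le_exp.2 (hyoung t ω)
  have hzi : Integrable z μ := integrable_of_mem_interior_integrableExpSet (by
    rw [show integrableExpSet z μ = Set.univ from Set.eq_univ_of_forall hint]; simp)
  refine ⟨hint, fun t => ?_⟩
  rw [Real.coe_toNNReal _ (by positivity), show 2 * L ^ 2 * t ^ 2 / 2 = t ^ 2 * L ^ 2 by ring, mgf]
  -- For small `t`, `exp x ≤ x + exp (x²)` is used: the linear term has mean zero. For large `t`,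
  -- Young's inequality suffices, since the factor `3/2` from the half exponent is below `exp
  -- (t²L²/2)`.
  rcases le_or_gt (t ^ 2 * L ^ 2) 1 with hs | hs
  · obtain ⟨hi, hi'⟩ := hdom (t ^ 2 * L ^ 2) (by positivity) hs
    have e : ∀ ω, t ^ 2 * L ^ 2 * (z ω ^ 2 / L ^ 2) = (t * z ω) ^ 2 := by
      intro ω; field_simp
    simp only [e] at hi hi'
    calc ∫ ω, Real.exp (t * z ω) ∂μ ≤ ∫ ω, (t * z ω + Real.exp ((t * z ω) ^ 2)) ∂μ :=
          integral_mono (hint t) ((hzi.const_mul t).add hi) fun ω => exp_le_self_add_exp_sq _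
      _ ≤ 1 + t ^ 2 * L ^ 2 := by
          rw [integral_add (hzi.const_mul t) hi, integral_const_mul, h0]; linarith
      _ ≤ _ := by linarith [Real.add_one_le_exp (t ^ 2 * L ^ 2)]
  · calc ∫ ω, Real.exp (t * z ω) ∂μ
        ≤ ∫ ω, Real.exp (t ^ 2 * L ^ 2 / 2) * Real.exp (1 / 2 * (z ω ^ 2 / L ^ 2)) ∂μ := by
          refine integral_mono (hint t) (hhalf.const_mul _) fun ω => ?_
          simp only [← Real.exp_add]
          exact Real.exp_le_exp.2 (hyoung t ω)
      _ ≤ Real.exp (t ^ 2 * L ^ 2 / 2) * Real.exp (t ^ 2 * L ^ 2 / 2) := by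
          rw [integral_const_mul]
          gcongr
          linarith [Real.add_one_le_exp (t ^ 2 * L ^ 2 / 2)]
      _ = _ := by rw [← Real.exp_add]; ring_nf

theorem lintegral_exp_sq_div_four_gaussianReal :
    ∫⁻ g, ENNReal.ofReal (Real.exp (g ^ 2 / 4)) ∂(gaussianReal 0 1) = ENNReal.ofReal (√2) := by
  rw [gaussianReal_of_var_ne_zero _ one_ne_zero,
    lintegral_withDensity_eq_lintegral_mul _ (measurable_gaussianPDF _ _) (by fun_prop)]
  have e : ∀ g : ℝ, (gaussianPDF 0 1 * fun g => ENNReal.ofReal (Real.exp (g ^ 2 / 4))) g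
      = ENNReal.ofReal ((√(2 * Real.pi))⁻¹ * Real.exp (-(1 / 4) * g ^ 2)) := by
    intro g
    rw [Pi.mul_apply, gaussianPDF, ← ENNReal.ofReal_mul (gaussianPDFReal_nonneg _ _ _),
      gaussianPDFReal]
    simp only [NNReal.coe_one, mul_one, sub_zero]
    rw [mul_assoc, ← Real.exp_add]
    ring_nf
  simp only [e]
  rw [← ofReal_integral_eq_lintegral_ofReal
    ((integrable_exp_neg_mul_sq (by norm_num)).const_mul _) (ae_of_all _ fun g => by positivity),
    integral_const_mul, integral_gaussian]
  congr 1
  rw [show Real.pi / (1 / 4) = 2 * Real.pi * 2 by ring,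
    Real.sqrt_mul (x := 2 * Real.pi) (by positivity) 2,
    inv_mul_cancel_left₀ (by positivity)]

/-- Gaussian linearisation: `exp (Y²/(4c))` is the mean of `exp (r g Y)` over an independent
standard Gaussian `g` with `r² = 1/(2c)`. After Tonelli, the moment generating function bound for
`Y` leaves `E exp (g²/4) = √2`. -/
theorem lintegral_exp_sq_le [IsProbabilityMeasure μ] {Y : Ω → ℝ} (hY : Measurable Y) {c : NNReal}
    (hc : 0 < c) (h : HasSubgaussianMGF Y c μ) :
    ∫⁻ ω, ENNReal.ofReal (Real.exp (Y ω ^ 2 / (4 * c))) ∂μ ≤ ENNReal.ofReal (√2) := by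
  have hc' : (0 : ℝ) < c := hc
  set r : ℝ := √(1 / (2 * c)) with hr
  have hr2 : r ^ 2 = 1 / (2 * c) := Real.sq_sqrt (by positivity)
  have e : ∀ ω, ENNReal.ofReal (Real.exp (Y ω ^ 2 / (4 * c)))
      = ∫⁻ g, ENNReal.ofReal (Real.exp (r * g * Y ω)) ∂(gaussianReal 0 1) := by
    intro ω
    have hm := mgf_gaussianReal (p := gaussianReal 0 1) (X := id) (μ := 0) (v := 1)
      (by simp) (r * Y ω)
    have hi : Integrable (fun g : ℝ => Real.exp (r * Y ω * g)) (gaussianReal 0 1) :=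
      integrable_exp_mul_gaussianReal _
    simp only [mgf, id, NNReal.coe_one, one_mul, zero_mul, zero_add] at hm
    have e2 : Y ω ^ 2 / (4 * c) = (r * Y ω) ^ 2 / 2 := by rw [mul_pow, hr2]; field_simp; norm_num
    rw [e2, ← hm, ofReal_integral_eq_lintegral_ofReal hi
      (ae_of_all _ fun g => (Real.exp_pos _).le)]
    refine lintegral_congr fun g => ?_
    ring_nf
  calc _ = ∫⁻ ω, ∫⁻ g, ENNReal.ofReal (Real.exp (r * g * Y ω)) ∂(gaussianReal 0 1) ∂μ :=
        lintegral_congr e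
    _ = ∫⁻ g, ∫⁻ ω, ENNReal.ofReal (Real.exp (r * g * Y ω)) ∂μ ∂(gaussianReal 0 1) :=
        lintegral_lintegral_swap (by fun_prop)
    _ ≤ ∫⁻ g, ENNReal.ofReal (Real.exp (g ^ 2 / 4)) ∂(gaussianReal 0 1) := by
        refine lintegral_mono fun g => ?_
        rw [← ofReal_integral_eq_lintegral_ofReal (h.integrable_exp_mul (r * g))
          (ae_of_all _ fun g => (Real.exp_pos _).le)]
        refine ENNReal.ofReal_le_ofReal ((h.mgf_le (r * g)).trans (Real.exp_le_exp.2 ?_))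
        rw [mul_pow, hr2]
        exact le_of_eq (by field_simp; ring)
    _ = _ := lintegral_exp_sq_div_four_gaussianReal

/-- A Bernstein-type bound for the moment generating function of a centred squared
sub-gaussian variable. -/
theorem mgf_sq_sub_one_le [IsProbabilityMeasure μ] {Y : Ω → ℝ} (hY : Measurable Y) {c : NNReal}
    (hc : 1 ≤ c) (h : HasSubgaussianMGF Y c μ) (h1 : ∫ ω, Y ω ^ 2 ∂μ = 1) {t : ℝ}
    (ht : |t| ≤ 1 / (8 * c)) :
    Integrable (fun ω => Real.exp (t * (Y ω ^ 2 - 1))) μ ∧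
      mgf (fun ω => Y ω ^ 2 - 1) μ t ≤ Real.exp (256 * c ^ 2 * t ^ 2) := by
  have hc' : (1 : ℝ) ≤ c := hc
  obtain ⟨hW, hW2⟩ := integrable_exp_of_lintegral_le (μ := μ) (f := fun ω => Y ω ^ 2 / (4 * c))
    (by fun_prop) (Real.sqrt_nonneg 2) (lintegral_exp_sq_le hY (by positivity) h)
  have hY2 : Integrable (fun ω => Y ω ^ 2) μ := (h.memLp 2).integrable_sq
  have hexp : Real.exp (1 / 4) * √2 ≤ 2 := by
    have a : Real.exp (1 / 4) ^ 4 ≤ 4 := by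
      rw [← Real.exp_nat_mul]; norm_num; linarith [Real.exp_one_lt_d9]
    have b : √2 ^ 4 = 4 := by
      rw [show √2 ^ 4 = (√2 ^ 2) ^ 2 by ring, Real.sq_sqrt (by norm_num)]; norm_num
    have : (Real.exp (1 / 4) * √2) ^ 4 ≤ 2 ^ 4 := by rw [mul_pow, b]; linarith
    exact le_of_pow_le_pow_left₀ (by norm_num) (by norm_num) this
  have key : ∀ ω, Real.exp (t * (Y ω ^ 2 - 1)) ≤ 1 + t * (Y ω ^ 2 - 1)
      + 128 * c ^ 2 * t ^ 2 * Real.exp (1 / 4) * Real.exp (Y ω ^ 2 / (4 * c)) := by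
    intro ω
    refine (exp_le_one_add_self_add_sq_mul_exp_abs _).trans (add_le_add le_rfl ?_)
    set v := |Y ω ^ 2 - 1| with hv
    have hv0 : 0 ≤ v := abs_nonneg _
    have hv1 : v ≤ Y ω ^ 2 + 1 := by
      rw [hv, abs_le]; constructor <;> nlinarith [sq_nonneg (Y ω)]
    have htv : |t * (Y ω ^ 2 - 1)| ≤ v / (8 * c) := by
      rw [abs_mul, ← hv, div_eq_mul_one_div, mul_comm]; gcongr
    -- By `x²/2 ≤ exp x`, the square costs one factor `exp (v/(8c))`. The remainder term supplies
    -- another, and together they reach `exp (v/(4c))`, the exponent known to be integrable.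
    have h2 : v ^ 2 ≤ 128 * c ^ 2 * Real.exp (v / (8 * c)) := by
      have := Real.quadratic_le_exp_of_nonneg (x := v / (8 * c)) (by positivity)
      have e : v ^ 2 = 128 * c ^ 2 * ((v / (8 * c)) ^ 2 / 2) := by field_simp; ring
      rw [e]
      gcongr
      have : 0 ≤ v / (8 * c) := by positivity
      linarith
    calc (t * (Y ω ^ 2 - 1)) ^ 2 * Real.exp |t * (Y ω ^ 2 - 1)|
        ≤ (t ^ 2 * (128 * c ^ 2 * Real.exp (v / (8 * c)))) * Real.exp (v / (8 * c)) := by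
          rw [mul_pow, ← sq_abs (Y ω ^ 2 - 1), ← hv]
          gcongr
      _ = 128 * c ^ 2 * t ^ 2 * Real.exp (v / (4 * c)) := by
          have : Real.exp (v / (4 * c)) = Real.exp (v / (8 * c)) * Real.exp (v / (8 * c)) := by
            rw [← Real.exp_add]; congr 1; field_simp; ring
          rw [this]; ring
      _ ≤ 128 * c ^ 2 * t ^ 2 * (Real.exp (1 / 4) * Real.exp (Y ω ^ 2 / (4 * c))) := by
          gcongr
          rw [← Real.exp_add]
          gcongr
          calc v / (4 * c) ≤ (Y ω ^ 2 + 1) / (4 * c) := by gcongr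
            _ = 1 / (4 * c) + Y ω ^ 2 / (4 * c) := by ring
            _ ≤ 1 / 4 + Y ω ^ 2 / (4 * c) := by
              gcongr
              linarith
      _ = _ := by ring
  have hsub : Integrable (fun ω => t * (Y ω ^ 2 - 1)) μ :=
    (hY2.sub (integrable_const _)).const_mul _
  have hb1 : Integrable (fun ω => 1 + t * (Y ω ^ 2 - 1)) μ := (integrable_const _).add hsub
  have hb2 := hW.const_mul (128 * c ^ 2 * t ^ 2 * Real.exp (1 / 4))
  have hi : Integrable (fun ω => Real.exp (t * (Y ω ^ 2 - 1))) μ := by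
    refine (hb1.add hb2).mono' (by fun_prop) (ae_of_all _ fun ω => ?_)
    rw [Real.norm_eq_abs, abs_of_pos (Real.exp_pos _)]
    exact key ω
  refine ⟨hi, ?_⟩
  calc mgf (fun ω => Y ω ^ 2 - 1) μ t ≤ _ := integral_mono hi (hb1.add hb2) key
    _ = 1 + 128 * c ^ 2 * t ^ 2 * Real.exp (1 / 4) * ∫ ω, Real.exp (Y ω ^ 2 / (4 * c)) ∂μ := by
        rw [integral_add' hb1 hb2, integral_const_mul, integral_add (integrable_const _) hsub,
          integral_const_mul, integral_sub hY2 (integrable_const _), h1]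
        simp
    _ ≤ 1 + 128 * c ^ 2 * t ^ 2 * 2 := by
        rw [mul_assoc (128 * (c : ℝ) ^ 2 * t ^ 2)]
        gcongr
        exact le_trans (by gcongr) hexp
    _ ≤ _ := by linarith [Real.add_one_le_exp (256 * (c : ℝ) ^ 2 * t ^ 2)]

end

/-! ### Bernstein bound for one unit vector -/

section
variable {Ω : Type*} [MeasurableSpace Ω] {μ : Measure Ω}

/-- The joint law of the entries is a product measure over pairs, and currying makes it a product
over rows of products over columns. -/
theorem iIndepFun_rows {ι κ : Type*} {X : ι → κ → Ω → ℝ} (hX : ∀ i j, Measurable (X i j))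
    (h : iIndepFun (fun (x : ι × κ) => X x.1 x.2) μ) :
    iIndepFun (fun i ω j => X i j ω) μ := by
  have := h.isProbabilityMeasure
  have : ∀ i j, IsProbabilityMeasure (μ.map (X i j)) :=
    fun i j => Measure.isProbabilityMeasure_map (hX i j).aemeasurable
  have hrow : ∀ i, iIndepFun (fun j => X i j) μ := fun i =>
    h.precomp (g := fun j => (i, j)) fun a b hab => by simpa using hab
  rw [iIndepFun_iff_map_fun_eq_infinitePi_map (by fun_prop)]
  have e : (fun ω i j => X i j ω)
      = MeasurableEquiv.curry ι κ ℝ ∘ (fun ω (x : ι × κ) => X x.1 x.2 ω) := by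
    ext; simp [MeasurableEquiv.curry]
  rw [e, ← Measure.map_map (by fun_prop) (by fun_prop),
    (iIndepFun_iff_map_fun_eq_infinitePi_map (by fun_prop)).1 h,
    Measure.infinitePi_map_curry (fun i j => μ.map (X i j))]
  congrm Measure.infinitePi fun i => ?_
  rw [(iIndepFun_iff_map_fun_eq_infinitePi_map (by fun_prop)).1 (hrow i)]

theorem measure_sum_sq_sub_one_ge_le [IsProbabilityMeasure μ] {ι : Type*} [Fintype ι] [Nonempty ι]
    {Y : ι → Ω → ℝ} (hY : ∀ i, Measurable (Y i)) {c : NNReal} (hc : 1 ≤ c)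
    (h : ∀ i, HasSubgaussianMGF (Y i) c μ) (h1 : ∀ i, ∫ ω, Y i ω ^ 2 ∂μ = 1)
    (hind : iIndepFun Y μ) {m : ℝ} (hm : 0 ≤ m) :
    μ.real {ω | 48 * c * (√(m / Fintype.card ι) + m / Fintype.card ι) * Fintype.card ι
      ≤ |∑ i, (Y i ω ^ 2 - 1)|} ≤ 2 * Real.exp (-(2 * m)) := by
  have hc' : (1 : ℝ) ≤ c := hc
  have hN : (0 : ℝ) < Fintype.card ι := by exact_mod_cast Fintype.card_pos
  set N : ℝ := (Fintype.card ι : ℝ) with hNdef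
  set r : ℝ := √(m / N) with hr
  have hr0 : 0 ≤ r := Real.sqrt_nonneg _
  have hr2 : r ^ 2 = m / N := Real.sq_sqrt (by positivity)
  have hNr : N * r ^ 2 = m := by rw [hr2]; field_simp
  rw [← hr2]
  set τ : ℝ := 48 * c * (r + r ^ 2) * N with hτ
  -- The Chernoff parameter is `±a/(8c)`: proportional to `r` in the Gaussian regime, capped at the
  -- largest value the moment bound allows in the exponential one. With `N r² = m`, the exponent is
  -- at most `-6m + 4m = -2m`.
  set a : ℝ := min r 1 with ha
  have ha0 : 0 ≤ a := le_min hr0 zero_le_one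
  have har : r ^ 2 ≤ a * (r + r ^ 2) := by
    rcases le_total r 1 with hr1 | hr1
    · rw [ha, min_eq_left hr1]; nlinarith [pow_nonneg hr0 3]
    · rw [ha, min_eq_right hr1]; linarith
  have har2 : a ^ 2 ≤ r ^ 2 := pow_le_pow_left₀ ha0 (min_le_left _ _) 2
  have hexpo : ∀ t : ℝ, |t| = a / (8 * c) → -(a / (8 * c)) * τ + N * (256 * c ^ 2 * t ^ 2)
      ≤ -(2 * m) := by
    intro t ht
    have e1 : a / (8 * c) * τ = 6 * N * (a * (r + r ^ 2)) := by
      rw [hτ]; field_simp; ring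
    have e2 : N * (256 * c ^ 2 * t ^ 2) = 4 * N * a ^ 2 := by
      rw [← sq_abs t, ht]; field_simp; ring
    have e3 := mul_le_mul_of_nonneg_left har hN.le
    have e4 := mul_le_mul_of_nonneg_left har2 hN.le
    nlinarith
  have hbound : ∀ t : ℝ, |t| = a / (8 * c) →
      Integrable (fun ω => Real.exp (t * ∑ i, (Y i ω ^ 2 - 1))) μ ∧
      mgf (fun ω => ∑ i, (Y i ω ^ 2 - 1)) μ t ≤ Real.exp (N * (256 * c ^ 2 * t ^ 2)) := by
    intro t ht
    have ht' : |t| ≤ 1 / (8 * c) := by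
      rw [ht]; gcongr; exact min_le_right _ _
    have hi' : iIndepFun (fun i ω => Y i ω ^ 2 - 1) μ :=
      hind.comp (fun _ y => y ^ 2 - 1) (fun _ => by fun_prop)
    have e : (fun ω => ∑ i, (Y i ω ^ 2 - 1)) = ∑ i, fun ω => Y i ω ^ 2 - 1 := by
      ext ω; simp
    constructor
    · have := hi'.integrable_exp_mul_sum (fun i => by fun_prop) (s := Finset.univ) (t := t)
        fun i _ => (mgf_sq_sub_one_le (hY i) hc (h i) (h1 i) ht').1
      simpa using this
    · rw [e, hi'.mgf_sum (fun i => by fun_prop)]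
      calc ∏ i, mgf (fun ω => Y i ω ^ 2 - 1) μ t
          ≤ ∏ _i : ι, Real.exp (256 * c ^ 2 * t ^ 2) :=
            Finset.prod_le_prod (fun i _ => mgf_nonneg) fun i _ =>
              (mgf_sq_sub_one_le (hY i) hc (h i) (h1 i) ht').2
        _ = _ := by rw [Finset.prod_const, ← Real.exp_nat_mul, Finset.card_univ]
  have hs0 : 0 ≤ a / (8 * c) := by positivity
  have up : μ.real {ω | τ ≤ ∑ i, (Y i ω ^ 2 - 1)} ≤ Real.exp (-(2 * m)) := by
    obtain ⟨hi, hb⟩ := hbound (a / (8 * c)) (abs_of_nonneg hs0)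
    refine (measure_ge_le_exp_mul_mgf τ hs0 hi).trans ?_
    refine (mul_le_mul_of_nonneg_left hb (Real.exp_pos _).le).trans ?_
    rw [← Real.exp_add]
    exact Real.exp_le_exp.2 (hexpo _ (abs_of_nonneg hs0))
  have lo : μ.real {ω | ∑ i, (Y i ω ^ 2 - 1) ≤ -τ} ≤ Real.exp (-(2 * m)) := by
    have habs : |-(a / (8 * c))| = a / (8 * c) := by rw [abs_neg, abs_of_nonneg hs0]
    obtain ⟨hi, hb⟩ := hbound (-(a / (8 * c))) habs
    refine (measure_le_le_exp_mul_mgf (-τ) (neg_nonpos.2 hs0) hi).trans ?_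
    refine (mul_le_mul_of_nonneg_left hb (Real.exp_pos _).le).trans ?_
    rw [← Real.exp_add]
    refine Real.exp_le_exp.2 (le_trans (le_of_eq ?_) (hexpo _ habs))
    ring
  calc _ ≤ μ.real ({ω | τ ≤ ∑ i, (Y i ω ^ 2 - 1)} ∪ {ω | ∑ i, (Y i ω ^ 2 - 1) ≤ -τ}) := by
        refine measureReal_mono fun ω hω => ?_
        rcases le_abs.1 (Set.mem_ofPred.1 hω) with h | h
        · exact Or.inl h
        · exact Or.inr (Set.mem_ofPred.2 (by linarith))
    _ ≤ _ := measureReal_union_le _ _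
    _ ≤ _ := by linarith

theorem hasSubgaussianMGF_dotProduct [IsProbabilityMeasure μ] {κ : Type*} [Fintype κ]
    {X : κ → Ω → ℝ} {c : NNReal}
    (h : ∀ j, HasSubgaussianMGF (X j) c μ) (h0 : ∀ j, ∫ ω, X j ω ∂μ = 0)
    (hv : ∀ j, variance (X j) μ = 1) (hind : iIndepFun X μ) {x : κ → ℝ} (hx : x ⬝ᵥ x = 1) :
    HasSubgaussianMGF (fun ω => ∑ j, X j ω * x j) c μ ∧
      ∫ ω, (∑ j, X j ω * x j) ^ 2 ∂μ = 1 := by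
  have hx' : ∑ j, x j ^ 2 = 1 := by simpa [dotProduct, sq] using hx
  have hi : iIndepFun (fun j ω => x j * X j ω) μ :=
    hind.comp (fun j y => x j * y) (fun _ => by fun_prop)
  have hs := HasSubgaussianMGF.sum_of_iIndepFun hi (s := Finset.univ)
    fun j _ => (h j).const_mul (x j)
  have hmem : ∀ j, MemLp (fun ω => x j * X j ω) 2 μ := fun j => ((h j).memLp 2).const_mul _
  have ec : ∑ j, (NNReal.mk (x j ^ 2) (sq_nonneg _)) * c = c := by
    rw [← Finset.sum_mul]
    have : ∑ j, NNReal.mk (x j ^ 2) (sq_nonneg _) = 1 := by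
      apply NNReal.eq
      push_cast
      exact hx'
    rw [this, one_mul]
  simp only [mul_comm (X _ _)]
  refine ⟨ec ▸ hs, ?_⟩
  have hm0 : ∫ ω, ∑ j, x j * X j ω ∂μ = 0 := by
    rw [integral_finsetSum _ fun j _ => (hmem j).integrable (by norm_num)]
    simp [integral_const_mul, h0]
  have e : (fun ω => ∑ j, x j * X j ω) = ∑ j, fun ω => x j * X j ω := by ext ω; simp
  rw [← variance_of_integral_eq_zero hs.aemeasurable hm0, e,
    IndepFun.variance_sum (fun j _ => hmem j) fun i _ j _ hij => hi.indepFun hij]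
  simp [variance_const_mul, hv, hx']

/-- Pointwise deviation of `‖Zx‖²` from its mean, for one unit vector `x`. -/
theorem measure_mulVec_sq_deviation_le [IsProbabilityMeasure μ] {ι κ : Type*} [Fintype ι]
    [Nonempty ι] [Fintype κ] {Z : Ω → Matrix ι κ ℝ} (hZ : ∀ i j, Measurable fun ω => Z ω i j)
    {M : ℝ} (hM : 1 ≤ M) (hsub : ∀ i j, SubgaussianBound (fun ω => Z ω i j) μ M)
    (h0 : ∀ i j, ∫ ω, Z ω i j ∂μ = 0) (hv : ∀ i j, variance (fun ω => Z ω i j) μ = 1)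
    (hind : iIndepFun (fun (x : ι × κ) ω => Z ω x.1 x.2) μ) {x : κ → ℝ} (hx : x ⬝ᵥ x = 1)
    {m : ℝ} (hm : 0 ≤ m) :
    μ.real {ω | 96 * M ^ 2 * (√(m / Fintype.card ι) + m / Fintype.card ι) * Fintype.card ι
      ≤ |(Z ω).mulVec x ⬝ᵥ (Z ω).mulVec x - Fintype.card ι|} ≤ 2 * Real.exp (-(2 * m)) := by
  have hc : (1 : NNReal) ≤ (2 * M ^ 2).toNNReal := by
    rw [← Real.toNNReal_one]; exact Real.toNNReal_le_toNNReal (by nlinarith)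
  have hrows : ∀ i, iIndepFun (fun j ω => Z ω i j) μ := fun i =>
    hind.precomp (g := fun j => (i, j)) fun a b hab => by simpa using hab
  have hlin := fun i => hasSubgaussianMGF_dotProduct
    (fun j => (hsub i j).hasSubgaussianMGF (by linarith) (hZ i j) (h0 i j)) (h0 i) (hv i)
    (hrows i) hx
  have hindY : iIndepFun (fun i ω => ∑ j, Z ω i j * x j) μ :=
    (iIndepFun_rows (X := fun i j ω => Z ω i j) hZ hind).comp
      (fun _ z => ∑ j, z j * x j) (fun _ => by fun_prop)
  have := measure_sum_sq_sub_one_ge_le (fun i => by fun_prop) hc (fun i => (hlin i).1)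
    (fun i => (hlin i).2) hindY hm
  rw [Real.coe_toNNReal _ (by positivity)] at this
  convert this using 6 with ω
  · ring
  · simp [dotProduct, Matrix.mulVec, Finset.sum_sub_distrib, sq]
end

/-! ### From a net to the whole sphere -/

/-- A `1/2`-separated subset of the sphere of maximal cardinality is a net, as a point far from it
could be added. Doubled, it is 1-separated in the ball of radius 2, where the volume bound `5^d`
applies. -/
theorem exists_half_net (E : Type*) [NormedAddCommGroup E] [NormedSpace ℝ E]
    [FiniteDimensional ℝ E] : ∃ S : Finset E, S.card ≤ 5 ^ Module.finrank ℝ E ∧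
      (∀ y ∈ S, ‖y‖ = 1) ∧ ∀ x : E, ‖x‖ = 1 → ∃ y ∈ S, ‖x - y‖ ≤ 1 / 2 := by
  classical
  let P : Finset E → Prop := fun S => (∀ y ∈ S, ‖y‖ = 1) ∧
    ∀ y ∈ S, ∀ z ∈ S, y ≠ z → 1 / 2 ≤ ‖y - z‖
  have hcard : ∀ S, P S → S.card ≤ 5 ^ Module.finrank ℝ E := by
    intro S hS
    have hinj : Function.Injective fun y : E => (2 : ℝ) • y := smul_right_injective E two_ne_zero
    rw [← Finset.card_image_of_injective S hinj]
    refine Besicovitch.card_le_of_separated _ ?_ ?_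
    · intro y hy
      obtain ⟨y, hy', rfl⟩ := Finset.mem_image.1 hy
      simp [norm_smul, hS.1 y hy']
    · intro y hy z hz hyz
      obtain ⟨y, hy', rfl⟩ := Finset.mem_image.1 hy
      obtain ⟨z, hz', rfl⟩ := Finset.mem_image.1 hz
      have := hS.2 y hy' z hz' (fun h => hyz (by rw [h]))
      rw [← smul_sub, norm_smul, Real.norm_two]
      linarith
  have hne : ({n | ∃ S, P S ∧ S.card = n} : Set ℕ).Nonempty := ⟨0, ∅, ⟨by simp, by simp⟩, rfl⟩
  have hbdd : BddAbove ({n | ∃ S, P S ∧ S.card = n} : Set ℕ) :=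
    ⟨5 ^ Module.finrank ℝ E, by rintro n ⟨S, hS, rfl⟩; exact hcard S hS⟩
  obtain ⟨S, hS, hSn⟩ := Nat.sSup_mem hne hbdd
  refine ⟨S, hcard S hS, hS.1, fun x hx => ?_⟩
  by_contra! hfar
  have hxS : x ∉ S := fun h => by have := hfar x h; norm_num at this
  have hP : P (insert x S) := by
    refine ⟨fun y hy => ?_, fun y hy z hz hyz => ?_⟩
    · rcases Finset.mem_insert.1 hy with rfl | hy
      exacts [hx, hS.1 y hy]
    · rcases Finset.mem_insert.1 hy with rfl | hy' <;> rcases Finset.mem_insert.1 hz with rfl | hz'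
      · exact absurd rfl hyz
      · exact (hfar z hz').le
      · rw [norm_sub_rev]; exact (hfar y hy').le
      · exact hS.2 y hy' z hz' hyz
  have := le_csSup hbdd ⟨_, hP, rfl⟩
  rw [← hSn, Finset.card_insert_of_notMem hxS] at this
  omega

/-- A symmetric bilinear form that is small on a `1/2`-net of the sphere is small everywhere. -/
theorem abs_quadForm_le_of_half_net {E : Type*} [NormedAddCommGroup E] [InnerProductSpace ℝ E]
    [FiniteDimensional ℝ E] {b : E → E → ℝ} (hcont : Continuous fun x => b x x)
    (hpol : ∀ u v, 4 * b u v = b (u + v) (u + v) - b (u - v) (u - v))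
    (hdiff : ∀ x y, b x x - b y y = b (x - y) (x + y))
    (hsmul : ∀ (s t : ℝ) u v, b (s • u) (t • v) = s * t * b u v) {S : Finset E}
    (hS : ∀ x : E, ‖x‖ = 1 → ∃ y ∈ S, ‖x - y‖ ≤ 1 / 2) (hS1 : ∀ y ∈ S, ‖y‖ = 1) {w : ℝ}
    (hw : ∀ y ∈ S, |b y y| ≤ w) (x : E) : |b x x| ≤ 100 / 3 * w * ‖x‖ ^ 2 := by
  rcases eq_or_ne x 0 with rfl | hx
  · have := hsmul 0 0 0 0
    simp only [zero_smul, zero_mul] at this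
    simp [this]
  have hunit : ∀ z : E, z ≠ 0 → ‖(‖z‖⁻¹ : ℝ) • z‖ = 1 := fun z hz => norm_smul_inv_norm hz
  have hne : (Metric.sphere (0 : E) 1).Nonempty := ⟨_, mem_sphere_zero_iff_norm.2 (hunit x hx)⟩
  -- The maximum `m` of the quadratic form also bounds the bilinear form, by polarisation. Comparing
  -- a maximiser with a nearby net point then gives `m ≤ 0.97 m + w`.
  obtain ⟨x₀, hx₀, hmax⟩ := (isCompact_sphere (0 : E) 1).exists_isMaxOn hne
    (hcont.abs.continuousOn)
  rw [mem_sphere_zero_iff_norm] at hx₀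
  set m := |b x₀ x₀| with hm
  have hall : ∀ z, |b z z| ≤ m * ‖z‖ ^ 2 := by
    intro z
    rcases eq_or_ne z 0 with rfl | hz
    · have := hsmul 0 0 0 0
      simp only [zero_smul, zero_mul] at this
      simp [this]
    have h1 : |b ((‖z‖⁻¹ : ℝ) • z) ((‖z‖⁻¹ : ℝ) • z)| ≤ m :=
      hmax (mem_sphere_zero_iff_norm.2 (hunit z hz))
    have hz' : 0 < ‖z‖ := norm_pos_iff.2 hz
    rw [hsmul, abs_mul, abs_of_nonneg (by positivity)] at h1
    have e : |b z z| = ‖z‖ ^ 2 * (‖z‖⁻¹ * ‖z‖⁻¹ * |b z z|) := by field_simp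
    rw [e, mul_comm m]
    gcongr
  have hbil1 : ∀ u v, ‖u‖ = 1 → ‖v‖ = 1 → |b u v| ≤ m := by
    intro u v hu hv
    have hp := parallelogram_law_with_norm ℝ u v
    have h4 : |4 * b u v| ≤ m * ‖u + v‖ ^ 2 + m * ‖u - v‖ ^ 2 := by
      rw [hpol]
      exact (abs_sub _ _).trans (add_le_add (hall _) (hall _))
    rw [abs_mul, abs_of_pos (by norm_num : (0 : ℝ) < 4)] at h4
    rw [hu, hv] at hp
    have h5 : m * ‖u + v‖ ^ 2 + m * ‖u - v‖ ^ 2 = m * 4 := by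
      rw [← mul_add, hp]; norm_num
    linarith
  have hbil : ∀ u v, |b u v| ≤ m * (‖u‖ * ‖v‖) := by
    intro u v
    rcases eq_or_ne u 0 with rfl | hu
    · have := hsmul 0 1 0 v
      simp only [zero_smul, one_smul, zero_mul] at this
      simp [this]
    rcases eq_or_ne v 0 with rfl | hv
    · have := hsmul 1 0 u 0
      simp only [zero_smul, one_smul, mul_zero, zero_mul] at this
      simp [this]
    have h1 := hbil1 _ _ (hunit u hu) (hunit v hv)
    have hu' : 0 < ‖u‖ := norm_pos_iff.2 hu
    have hv' : 0 < ‖v‖ := norm_pos_iff.2 hv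
    rw [hsmul, abs_mul, abs_of_nonneg (by positivity)] at h1
    have e : |b u v| = (‖u‖ * ‖v‖) * (‖u‖⁻¹ * ‖v‖⁻¹ * |b u v|) := by field_simp
    rw [e, mul_comm m]
    gcongr
  obtain ⟨y, hyS, hxy⟩ := hS x₀ hx₀
  have hp := parallelogram_law_with_norm ℝ x₀ y
  rw [hx₀, hS1 y hyS] at hp
  -- The triangle inequality would give only `1/2 · 2 = 1`, which is no contraction. By the
  -- parallelogram law, with `s = ‖x₀ - y‖² ≤ 1/4`, the square is `s (4 - s) ≤ 15/16 < 0.97²`. Hence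
  -- the constant `100/3 = 1/(1 - 0.97)`.
  have hprod : ‖x₀ - y‖ * ‖x₀ + y‖ ≤ 97 / 100 := by
    refine le_of_sq_le_sq ?_ (by norm_num)
    have h0 := norm_nonneg (x₀ - y)
    have e : (‖x₀ - y‖ * ‖x₀ + y‖) ^ 2 = ‖x₀ - y‖ ^ 2 * (4 - ‖x₀ - y‖ ^ 2) := by
      rw [mul_pow]; congr 1; nlinarith
    have h4 : ‖x₀ - y‖ ^ 2 ≤ 1 / 4 := by nlinarith
    rw [e]
    nlinarith [sq_nonneg ‖x₀ - y‖]
  have hm0 : 0 ≤ m := abs_nonneg _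
  have hmw : m ≤ 100 / 3 * w := by
    have h1 : |b x₀ x₀ - b y y| ≤ m * (97 / 100) := by
      rw [hdiff]
      exact (hbil _ _).trans (by gcongr)
    have h2 := hw y hyS
    have h3 : m ≤ |b x₀ x₀ - b y y| + |b y y| := by
      rw [hm]; simpa using abs_add_le (b x₀ x₀ - b y y) (b y y)
    linarith
  exact (hall x).trans (by gcongr)

theorem mulVec_sq_deviation_of_half_net {ι κ : Type*} [Fintype ι] [Fintype κ]
    (A : Matrix ι κ ℝ) (N : ℝ) {S : Finset (EuclideanSpace ℝ κ)}
    (hS : ∀ x : EuclideanSpace ℝ κ, ‖x‖ = 1 → ∃ y ∈ S, ‖x - y‖ ≤ 1 / 2)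
    (hS1 : ∀ y ∈ S, ‖y‖ = 1) {w : ℝ}
    (hw : ∀ y ∈ S, |A.mulVec y.ofLp ⬝ᵥ A.mulVec y.ofLp - N| ≤ w) (x : κ → ℝ) :
    |A.mulVec x ⬝ᵥ A.mulVec x - N * (x ⬝ᵥ x)| ≤ 100 / 3 * w * (x ⬝ᵥ x) := by
  have hnorm : ∀ y : EuclideanSpace ℝ κ, ‖y‖ ^ 2 = y.ofLp ⬝ᵥ y.ofLp := by
    intro y
    rw [EuclideanSpace.real_norm_sq_eq]
    simp [dotProduct, sq]
  have := abs_quadForm_le_of_half_net (E := EuclideanSpace ℝ κ)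
    (b := fun u v => A.mulVec u.ofLp ⬝ᵥ A.mulVec v.ofLp - N * (u.ofLp ⬝ᵥ v.ofLp))
    (by simp only [Matrix.mulVec, dotProduct]; fun_prop)
    (by
      intro u v
      simp only [WithLp.ofLp_add, WithLp.ofLp_sub, Matrix.mulVec_add, Matrix.mulVec_sub,
        add_dotProduct, dotProduct_add, sub_dotProduct, dotProduct_sub]
      rw [dotProduct_comm v.ofLp u.ofLp,
        dotProduct_comm (A.mulVec v.ofLp) (A.mulVec u.ofLp)]
      ring)
    (by
      intro u v
      simp only [WithLp.ofLp_add, WithLp.ofLp_sub, Matrix.mulVec_add, Matrix.mulVec_sub,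
        dotProduct_add, sub_dotProduct]
      rw [dotProduct_comm v.ofLp u.ofLp,
        dotProduct_comm (A.mulVec v.ofLp) (A.mulVec u.ofLp)]
      ring)
    (by
      intro s t u v
      simp only [WithLp.ofLp_smul, Matrix.mulVec_smul, smul_dotProduct, dotProduct_smul,
        smul_eq_mul]
      ring)
    hS hS1 (w := w)
    (by
      intro y hy
      have h1 := hnorm y
      rw [hS1 y hy, one_pow] at h1
      simpa [← h1] using hw y hy)
    (WithLp.toLp 2 x)
  simpa [hnorm] using this

/-- Since `5 < e²`, the net is absorbed by the factor `exp (-2k)` of the pointwise tail. -/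
theorem card_mul_exp_le_of_card_le_five_pow {c k : ℕ} {q : ℝ} (hq : 0 ≤ q) (hc : c ≤ 5 ^ k) :
    (c : ℝ) * (2 * Real.exp (-(2 * (k + q)))) ≤ 2 * Real.exp (-q) := by
  calc (c : ℝ) * (2 * Real.exp (-(2 * (k + q))))
      ≤ Real.exp (2 * k) * (2 * Real.exp (-(2 * (k + q)))) := by
        gcongr
        calc (c : ℝ) ≤ (5 : ℝ) ^ k := by exact_mod_cast hc
          _ ≤ (Real.exp 2) ^ k := by
            gcongr
            have : Real.exp 2 = Real.exp 1 * Real.exp 1 := by rw [← Real.exp_add]; norm_num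
            nlinarith [Real.exp_one_gt_d9]
          _ = _ := by rw [← Real.exp_nat_mul, mul_comm]
    _ = 2 * Real.exp (-(2 * q)) := by
        rw [mul_left_comm, ← Real.exp_add]; ring_nf
    _ ≤ _ := by gcongr; linarith

/-- Uniform deviation of `‖Zx‖²` from its mean for a matrix with independent standard
sub-gaussian entries. -/
theorem measure_exists_mulVec_sq_deviation_le {Ω : Type*} [MeasurableSpace Ω] {μ : Measure Ω}
    [IsProbabilityMeasure μ] {ι κ : Type*} [Fintype ι]
    [Nonempty ι] [Fintype κ] {Z : Ω → Matrix ι κ ℝ} (hZ : ∀ i j, Measurable fun ω => Z ω i j)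
    {M : ℝ} (hM : 1 ≤ M) (hsub : ∀ i j, SubgaussianBound (fun ω => Z ω i j) μ M)
    (h0 : ∀ i j, ∫ ω, Z ω i j ∂μ = 0) (hv : ∀ i j, variance (fun ω => Z ω i j) μ = 1)
    (hind : iIndepFun (fun (x : ι × κ) ω => Z ω x.1 x.2) μ) {q : ℝ} (hq : 0 ≤ q) :
    μ.real {ω | ¬ ∀ x : κ → ℝ,
      |(Z ω).mulVec x ⬝ᵥ (Z ω).mulVec x - Fintype.card ι * (x ⬝ᵥ x)| ≤
        3200 * M ^ 2 * (√((Fintype.card κ + q) / Fintype.card ι)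
          + (Fintype.card κ + q) / Fintype.card ι) * Fintype.card ι * (x ⬝ᵥ x)}
      ≤ 2 * Real.exp (-q) := by
  obtain ⟨S, hcard, hS1, hS⟩ := exists_half_net (EuclideanSpace ℝ κ)
  rw [finrank_euclideanSpace] at hcard
  have hunit : ∀ y ∈ S, y.ofLp ⬝ᵥ y.ofLp = 1 := by
    intro y hy
    have := EuclideanSpace.real_norm_sq_eq y
    rw [hS1 y hy] at this
    simpa [dotProduct, sq] using this.symm
  refine le_trans ?_ (card_mul_exp_le_of_card_le_five_pow hq hcard)
  rw [← nsmul_eq_mul, ← Finset.sum_const]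
  refine le_trans ?_ (Finset.sum_le_sum fun y hy =>
    measure_mulVec_sq_deviation_le hZ hM hsub h0 hv hind (hunit y hy) (by positivity))
  refine le_trans (measureReal_mono (fun ω hω => ?_) (measure_ne_top _ _))
    (measureReal_biUnion_finset_le _ _)
  by_contra hcon
  simp only [Set.mem_iUnion, not_exists, Set.mem_ofPred_eq, not_le] at hcon
  refine hω fun x => ?_
  have := mulVec_sq_deviation_of_half_net (Z ω) _ hS hS1 (fun y hy => (hcon y hy).le) x
  convert this using 1
  ring

/-! ### Pseudoinverse bounds and the block norm estimate -/

section
variable {m n : Type*} [Fintype m] [Fintype n]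

theorem dotProduct_self_nonneg_real (x : n → ℝ) : 0 ≤ x ⬝ᵥ x :=
  Finset.sum_nonneg fun i _ => mul_self_nonneg (x i)

theorem dotProduct_sq_le (x y : n → ℝ) : (x ⬝ᵥ y) ^ 2 ≤ (x ⬝ᵥ x) * (y ⬝ᵥ y) := by
  simpa [dotProduct, sq] using Finset.sum_mul_sq_le_sq_mul_sq Finset.univ x y

theorem mulVec_dotProduct_eq (A : Matrix m n ℝ) (x : n → ℝ) (y : m → ℝ) :
    A.mulVec x ⬝ᵥ y = x ⬝ᵥ A.transpose.mulVec y := by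
  rw [Matrix.mulVec_transpose, dotProduct_comm x, ← Matrix.dotProduct_mulVec, dotProduct_comm]

theorem mulVec_dotProduct_self_le_of_projection {P : Matrix n n ℝ} (h : P * P = P)
    (hs : P.transpose = P) (y : n → ℝ) : P.mulVec y ⬝ᵥ P.mulVec y ≤ y ⬝ᵥ y := by
  have e : P.mulVec y ⬝ᵥ P.mulVec y = y ⬝ᵥ P.mulVec y := by
    rw [mulVec_dotProduct_eq, hs, Matrix.mulVec_mulVec, h]
  have := dotProduct_self_nonneg_real (y - P.mulVec y)
  simp only [sub_dotProduct, dotProduct_sub] at this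
  rw [dotProduct_comm (P.mulVec y) y] at this
  linarith

theorem pinv_mul_self_mulVec_le (A : Matrix m n ℝ) (x : n → ℝ) :
    (pinv A * A).mulVec x ⬝ᵥ (pinv A * A).mulVec x ≤ x ⬝ᵥ x := by
  have h := isMoorePenrose_pinv A
  refine mulVec_dotProduct_self_le_of_projection ?_ h.symm_right x
  rw [← Matrix.mul_assoc, h.self_mul_mul]

theorem mul_pinv_self_mulVec_le (A : Matrix m n ℝ) (y : m → ℝ) :
    (A * pinv A).mulVec y ⬝ᵥ (A * pinv A).mulVec y ≤ y ⬝ᵥ y := by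
  have h := isMoorePenrose_pinv A
  refine mulVec_dotProduct_self_le_of_projection ?_ h.symm_left y
  rw [← Matrix.mul_assoc, h.mul_mul_self]

theorem pinv_mulVec_le_of_lower_bound {A : Matrix m n ℝ} {η : ℝ}
    (h : ∀ x, η * (x ⬝ᵥ x) ≤ A.mulVec x ⬝ᵥ A.mulVec x) (y : m → ℝ) :
    η * ((pinv A).mulVec y ⬝ᵥ (pinv A).mulVec y) ≤ y ⬝ᵥ y := by
  refine (h _).trans ?_
  rw [Matrix.mulVec_mulVec]
  exact mul_pinv_self_mulVec_le A y

/-- The vector `x = A⁺y` lies in the range of `Aᵀ`: `x = Aᵀw` with `w = (A⁺)ᵀx`. Then `‖x‖² = ⟨Ax,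
w⟩`, where `‖Ax‖ ≤ ‖y‖` because `AA⁺` is a projection, and the hypothesis bounds `w` by `x`. -/
theorem pinv_mulVec_le_of_transpose_lower_bound {A : Matrix m n ℝ} {η : ℝ}
    (h : ∀ y, η * (y ⬝ᵥ y) ≤ A.transpose.mulVec y ⬝ᵥ A.transpose.mulVec y)
    (y : m → ℝ) : η * ((pinv A).mulVec y ⬝ᵥ (pinv A).mulVec y) ≤ y ⬝ᵥ y := by
  have hP := isMoorePenrose_pinv A
  set x := (pinv A).mulVec y with hx
  set w := (pinv A).transpose.mulVec x with hw
  have hxw : A.transpose.mulVec w = x := by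
    rw [hw, Matrix.mulVec_mulVec, ← Matrix.transpose_mul, hP.symm_right, hx, Matrix.mulVec_mulVec,
      hP.self_mul_mul]
  have h1 : x ⬝ᵥ x = A.mulVec x ⬝ᵥ w := by
    rw [mulVec_dotProduct_eq A x w, hxw]
  have h2 : A.mulVec x ⬝ᵥ A.mulVec x ≤ y ⬝ᵥ y := by
    rw [hx, Matrix.mulVec_mulVec]; exact mul_pinv_self_mulVec_le A y
  have h3 := h w
  rw [hxw] at h3
  have h4 := dotProduct_sq_le (A.mulVec x) w
  rw [← h1] at h4
  have hw0 := dotProduct_self_nonneg_real w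
  have hy0 := dotProduct_self_nonneg_real y
  rcases (dotProduct_self_nonneg_real x).eq_or_lt with h0 | h0
  · rw [← h0, mul_zero]; exact hy0
  · rcases le_or_gt η 0 with hη | hη
    · exact (mul_nonpos_of_nonpos_of_nonneg hη h0.le).trans hy0
    refine le_of_mul_le_mul_right ?_ h0
    calc η * (x ⬝ᵥ x) * (x ⬝ᵥ x) = η * (x ⬝ᵥ x) ^ 2 := by ring
      _ ≤ η * ((y ⬝ᵥ y) * (w ⬝ᵥ w)) := by
          gcongr
          exact h4.trans (by gcongr)
      _ = (y ⬝ᵥ y) * (η * (w ⬝ᵥ w)) := by ring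
      _ ≤ (y ⬝ᵥ y) * (x ⬝ᵥ x) := by gcongr

/-- Cauchy–Schwarz with weights `c k`. Applied to each block row, it bounds the operator norm by the
Frobenius norm of the matrix of block norms. -/
theorem dotProduct_sum_self_le {κ : Type*} [Fintype κ] (v : κ → n → ℝ) {c t : κ → ℝ}
    (hc : ∀ k, 0 < c k) (hv : ∀ k, v k ⬝ᵥ v k ≤ c k * t k) :
    ∑ a, (∑ k, v k a) ^ 2 ≤ (∑ k, c k) * ∑ k, t k := by
  have hcs : 0 ≤ ∑ k, c k := Finset.sum_nonneg fun k _ => (hc k).le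
  calc ∑ a, (∑ k, v k a) ^ 2 ≤ ∑ a, (∑ k, c k) * ∑ k, v k a ^ 2 / c k := by
        refine Finset.sum_le_sum fun a _ => Finset.sum_sq_le_sum_mul_sum_of_sq_le_mul _
          (fun k _ => (hc k).le) (fun k _ => div_nonneg (sq_nonneg _) (hc k).le) fun k _ => ?_
        rw [mul_div_cancel₀ _ (hc k).ne']
    _ = (∑ k, c k) * ∑ k, (v k ⬝ᵥ v k) / c k := by
        rw [← Finset.mul_sum, Finset.sum_comm]
        simp only [dotProduct, Finset.sum_div, sq]
    _ ≤ _ := by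
        gcongr with k
        rw [div_le_iff₀ (hc k), mul_comm]
        exact hv k
end

theorem spectralNorm_iterMatrix_le {K n : ℕ} {p : Fin K → ℕ}
    (A : ∀ k, Matrix (Fin n) (Fin (p k)) ℝ) {c : Fin K → Fin K → ℝ} (hc : ∀ i k, 0 < c i k)
    (h : ∀ i k x, (pinv (A i) * A k).mulVec x ⬝ᵥ (pinv (A i) * A k).mulVec x
      ≤ c i k * (x ⬝ᵥ x)) :
    spectralNorm (iterMatrix A) ≤ 1 + 1 / K * √(∑ i, ∑ k, c i k) := by
  have hC : 0 ≤ ∑ i, ∑ k, c i k :=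
    Finset.sum_nonneg fun i _ => Finset.sum_nonneg fun k _ => (hc i k).le
  have hM : ‖Matrix.toEuclideanCLM (𝕜 := ℝ) (stackedPinv A * hcat A)‖ ≤ √(∑ i, ∑ k, c i k) := by
    refine ContinuousLinearMap.opNorm_le_bound _ (Real.sqrt_nonneg _) fun x => ?_
    refine le_of_sq_le_sq ?_ (by positivity)
    rw [mul_pow, Real.sq_sqrt hC, EuclideanSpace.real_norm_sq_eq, EuclideanSpace.real_norm_sq_eq,
      Fintype.sum_sigma, Fintype.sum_sigma, Finset.sum_mul]
    refine Finset.sum_le_sum fun i _ => ?_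
    have e : ∀ a, (Matrix.toEuclideanCLM (𝕜 := ℝ) (stackedPinv A * hcat A) x).ofLp ⟨i, a⟩
        = ∑ k, (pinv (A i) * A k).mulVec (fun b => x.ofLp ⟨k, b⟩) a := by
      intro a
      rw [Matrix.ofLp_toEuclideanCLM]
      simp [Matrix.mulVec, dotProduct, Fintype.sum_sigma, Matrix.mul_apply, stackedPinv, hcat]
    simp only [e]
    refine dotProduct_sum_self_le (fun k => (pinv (A i) * A k).mulVec fun b => x.ofLp ⟨k, b⟩)
      (hc i) fun k => ?_
    simpa [dotProduct, sq] using h i k fun b => x.ofLp ⟨k, b⟩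
  rw [spectralNorm, iterMatrix, map_sub, map_one, map_smul]
  refine (norm_sub_le _ _).trans (add_le_add ContinuousLinearMap.norm_id_le ?_)
  rw [norm_smul, Real.norm_of_nonneg (by positivity)]
  gcongr

/-! ### Extreme singular values and the spectrum of `Σ` -/

section SingularValues
variable {E F : Type*} [NormedAddCommGroup E] [InnerProductSpace ℝ E] [FiniteDimensional ℝ E]
  [NormedAddCommGroup F] [InnerProductSpace ℝ F] [FiniteDimensional ℝ F]

theorem norm_sq_apply_eq_sum_singularValues (T : E →ₗ[ℝ] F) {d : ℕ}
    (hd : Module.finrank ℝ E = d) (x : E) : ‖T x‖ ^ 2 = ∑ i : Fin d, T.singularValues i ^ 2 *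
      inner ℝ (T.isSymmetric_adjoint_comp_self.eigenvectorBasis hd i) x ^ 2 := by
  set hT := T.isSymmetric_adjoint_comp_self
  have e1 : ‖T x‖ ^ 2 = inner ℝ x ((T.adjoint ∘ₗ T) x) := by
    rw [LinearMap.comp_apply, LinearMap.adjoint_inner_right, real_inner_self_eq_norm_sq]
  rw [e1, ← (hT.eigenvectorBasis hd).sum_inner_mul_inner]
  refine Finset.sum_congr rfl fun i _ => ?_
  rw [← hT, hT.apply_eigenvectorBasis hd i, inner_smul_left, T.sq_singularValues_fin hd,
    real_inner_comm x]
  simp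
  ring

theorem norm_apply_le_singularValues_zero (T : E →ₗ[ℝ] F) (x : E) :
    ‖T x‖ ≤ T.singularValues 0 * ‖x‖ := by
  refine le_of_sq_le_sq ?_ (mul_nonneg (T.singularValues_nonneg 0) (norm_nonneg x))
  rw [norm_sq_apply_eq_sum_singularValues T rfl, mul_pow,
    ← (T.isSymmetric_adjoint_comp_self.eigenvectorBasis rfl).sum_sq_inner_right, Finset.mul_sum]
  refine Finset.sum_le_sum fun i _ => ?_
  gcongr
  · exact T.singularValues_nonneg i
  · exact T.singularValues_antitone (Nat.zero_le _)

/-- The index is tied to the dimension of the domain. It agrees with that of `sigmaMin` for square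
matrices, the case needed for `Σ`. -/
theorem singularValues_last_mul_norm_le (T : E →ₗ[ℝ] F) {d : ℕ}
    (hd : Module.finrank ℝ E = d) (x : E) : T.singularValues (d - 1) * ‖x‖ ≤ ‖T x‖ := by
  refine le_of_sq_le_sq ?_ (norm_nonneg _)
  rw [norm_sq_apply_eq_sum_singularValues T hd, mul_pow,
    ← (T.isSymmetric_adjoint_comp_self.eigenvectorBasis hd).sum_sq_inner_right, Finset.mul_sum]
  refine Finset.sum_le_sum fun i _ => ?_
  gcongr
  · exact T.singularValues_nonneg _
  · exact T.singularValues_antitone (by have := i.2; omega)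
end SingularValues

section Covariance
variable {p : ℕ} {lam : Fin p → ℝ} {U : Matrix (Fin p) (Fin p) ℝ}

/-- Testing on the eigenvectors `U eⱼ` places every `lam j` between `sigmaMin` and `sigmaMax`;
attainment of these extremes is not needed. -/
theorem norm_toEuclideanLin_eigenvector (hlam : ∀ j, 0 < lam j)
    (hU : U ∈ Matrix.orthogonalGroup (Fin p) ℝ) (j : Fin p) :
    ‖(WithLp.toLp 2 (U.mulVec (Pi.single j 1)) : EuclideanSpace ℝ (Fin p))‖ = 1 ∧
    ‖Matrix.toEuclideanLin (U * Matrix.diagonal lam * U.transpose)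
      (WithLp.toLp 2 (U.mulVec (Pi.single j 1)))‖ = lam j := by
  have hUU : U.transpose * U = 1 := (Matrix.mem_orthogonalGroup_iff' _ _).1 hU
  have h1 : ‖(WithLp.toLp 2 (U.mulVec (Pi.single j 1)) : EuclideanSpace ℝ (Fin p))‖ = 1 := by
    refine (sq_eq_sq₀ (norm_nonneg _) zero_le_one).1 ?_
    have : U.mulVec (Pi.single j 1) ⬝ᵥ U.mulVec (Pi.single j 1) = 1 := by
      rw [mulVec_dotProduct_eq, Matrix.mulVec_mulVec, hUU]; simp
    rw [EuclideanSpace.real_norm_sq_eq]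
    simpa [dotProduct, sq] using this
  refine ⟨h1, ?_⟩
  have : Matrix.toEuclideanLin (U * Matrix.diagonal lam * U.transpose)
      (WithLp.toLp 2 (U.mulVec (Pi.single j 1)))
      = lam j • (WithLp.toLp 2 (U.mulVec (Pi.single j 1)) : EuclideanSpace ℝ (Fin p)) := by
    rw [Matrix.toLpLin_toLp, Matrix.toLin'_apply, Matrix.mulVec_mulVec, Matrix.mul_assoc, hUU,
      Matrix.mul_one, ← Matrix.mulVec_mulVec, ← WithLp.toLp_smul, ← Matrix.mulVec_smul]
    congr 2
    ext a
    simp [Matrix.mulVec_diagonal, Pi.single_apply]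
    aesop
  rw [this, norm_smul, h1, mul_one, Real.norm_of_nonneg (hlam j).le]

theorem le_sigmaMax (hlam : ∀ j, 0 < lam j) (hU : U ∈ Matrix.orthogonalGroup (Fin p) ℝ)
    (j : Fin p) : lam j ≤ sigmaMax (U * Matrix.diagonal lam * U.transpose) := by
  obtain ⟨h1, h2⟩ := norm_toEuclideanLin_eigenvector hlam hU j
  have := norm_apply_le_singularValues_zero
    (Matrix.toEuclideanLin (U * Matrix.diagonal lam * U.transpose))
    (WithLp.toLp 2 (U.mulVec (Pi.single j 1)))
  rwa [h1, h2, mul_one] at this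

theorem sigmaMin_le (hlam : ∀ j, 0 < lam j) (hU : U ∈ Matrix.orthogonalGroup (Fin p) ℝ)
    (j : Fin p) : sigmaMin (U * Matrix.diagonal lam * U.transpose) ≤ lam j := by
  obtain ⟨h1, h2⟩ := norm_toEuclideanLin_eigenvector hlam hU j
  have := singularValues_last_mul_norm_le
    (Matrix.toEuclideanLin (U * Matrix.diagonal lam * U.transpose)) (finrank_euclideanSpace_fin)
    (WithLp.toLp 2 (U.mulVec (Pi.single j 1)))
  rw [h1, h2, mul_one] at this
  rwa [sigmaMin, min_self]

end Covariance

/-! ### Transfer of the deviation bounds from `Z` to the blocks -/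

theorem colouredBlock_apply {n p : ℕ} (Z : Matrix (Fin n) (Fin p) ℝ) (lam : Fin p → ℝ)
    (U : Matrix (Fin p) (Fin p) ℝ) (i : Fin n) (j : Fin p) :
    colouredBlock Z lam U i j = ∑ a, √(lam a) * U j a * Z i a := by
  rw [colouredBlock, Matrix.mul_apply]
  refine Finset.sum_congr rfl fun a _ => ?_
  rw [Matrix.mul_diagonal, Matrix.transpose_apply]
  ring

theorem colouredBlock_mulVec {n p : ℕ} (Z : Matrix (Fin n) (Fin p) ℝ) (lam : Fin p → ℝ)
    (U : Matrix (Fin p) (Fin p) ℝ) (x : Fin p → ℝ) : (colouredBlock Z lam U).mulVec x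
      = Z.mulVec (fun a => √(lam a) * U.transpose.mulVec x a) := by
  rw [colouredBlock, ← Matrix.mulVec_mulVec, ← Matrix.mulVec_mulVec]
  congr 1
  ext a
  rw [Matrix.mulVec_diagonal]

theorem colouredBlock_transpose_mulVec {n p : ℕ} (Z : Matrix (Fin n) (Fin p) ℝ) (lam : Fin p → ℝ)
    (U : Matrix (Fin p) (Fin p) ℝ) (y : Fin n → ℝ) : (colouredBlock Z lam U).transpose.mulVec y
      = U.mulVec (fun a => √(lam a) * Z.transpose.mulVec y a) := by
  rw [colouredBlock, Matrix.transpose_mul, Matrix.transpose_mul, Matrix.transpose_transpose,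
    Matrix.diagonal_transpose, ← Matrix.mulVec_mulVec, ← Matrix.mulVec_mulVec]
  congr 1
  ext a
  rw [Matrix.mulVec_diagonal]

theorem mulVec_dotProduct_self_of_orthogonal {p : ℕ} {U : Matrix (Fin p) (Fin p) ℝ}
    (hU : U ∈ Matrix.orthogonalGroup (Fin p) ℝ) (x : Fin p → ℝ) :
    U.mulVec x ⬝ᵥ U.mulVec x = x ⬝ᵥ x := by
  rw [mulVec_dotProduct_eq, Matrix.mulVec_mulVec, (Matrix.mem_orthogonalGroup_iff' _ _).1 hU,
    Matrix.one_mulVec]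

theorem transpose_mulVec_dotProduct_self_of_orthogonal {p : ℕ} {U : Matrix (Fin p) (Fin p) ℝ}
    (hU : U ∈ Matrix.orthogonalGroup (Fin p) ℝ) (x : Fin p → ℝ) :
    U.transpose.mulVec x ⬝ᵥ U.transpose.mulVec x = x ⬝ᵥ x := by
  rw [mulVec_dotProduct_eq, Matrix.mulVec_mulVec, Matrix.transpose_transpose,
    (Matrix.mem_orthogonalGroup_iff _ _).1 hU, Matrix.one_mulVec]

section
variable {n p : ℕ} {lam : Fin p → ℝ} {U : Matrix (Fin p) (Fin p) ℝ}

theorem sqrt_mul_dotProduct_self_le (hlam : ∀ j, 0 < lam j)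
    (hU : U ∈ Matrix.orthogonalGroup (Fin p) ℝ) (v : Fin p → ℝ) :
    (fun a => √(lam a) * v a) ⬝ᵥ (fun a => √(lam a) * v a)
      ≤ sigmaMax (U * Matrix.diagonal lam * U.transpose) * (v ⬝ᵥ v) := by
  simp only [dotProduct, Finset.mul_sum]
  refine Finset.sum_le_sum fun a _ => ?_
  rw [mul_mul_mul_comm, Real.mul_self_sqrt (hlam a).le]
  exact mul_le_mul_of_nonneg_right (le_sigmaMax hlam hU a) (mul_self_nonneg _)

theorem le_sqrt_mul_dotProduct_self (hlam : ∀ j, 0 < lam j)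
    (hU : U ∈ Matrix.orthogonalGroup (Fin p) ℝ) (v : Fin p → ℝ) :
    sigmaMin (U * Matrix.diagonal lam * U.transpose) * (v ⬝ᵥ v)
      ≤ (fun a => √(lam a) * v a) ⬝ᵥ (fun a => √(lam a) * v a) := by
  simp only [dotProduct, Finset.mul_sum]
  refine Finset.sum_le_sum fun a _ => ?_
  rw [mul_mul_mul_comm, Real.mul_self_sqrt (hlam a).le]
  exact mul_le_mul_of_nonneg_right (sigmaMin_le hlam hU a) (mul_self_nonneg _)

theorem sigmaMin_nonneg {m p : ℕ} (M : Matrix (Fin m) (Fin p) ℝ) : 0 ≤ sigmaMin M :=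
  LinearMap.singularValues_nonneg _ _

theorem sigmaMax_nonneg {m p : ℕ} (M : Matrix (Fin m) (Fin p) ℝ) : 0 ≤ sigmaMax M :=
  LinearMap.singularValues_nonneg _ _

theorem ell_nonneg {C L q : ℝ} (hC : 0 ≤ C) (hq : 0 ≤ q) (Sig : Matrix (Fin p) (Fin p) ℝ) :
    0 ≤ ell C L q n Sig := by
  have := sigmaMax_nonneg Sig
  unfold ell
  positivity

theorem eta_nonneg {C L q qbar : ℝ} (Sig : Matrix (Fin p) (Fin p) ℝ) :
    0 ≤ eta C L q qbar n Sig := by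
  have := sigmaMin_nonneg Sig
  unfold eta
  split_ifs
  · exact le_max_left _ _
  · positivity

/-- Turns the additive lower bound into the squared form in `eta`, at the price of doubling the
constant. With `u = √s`, the gap at `t = u` equals `2Du(√d - 2Du) + Du(√d - u)`, and both terms are
nonnegative. -/
theorem sqrt_sub_sq_le {s t D d : ℝ} (hs : 0 ≤ s) (hd : 0 < d) (hD : 1 ≤ D)
    (ht : √s ≤ t) (h : 2 * D * t < √d) :
    (√d - 2 * D * t) ^ 2 ≤ d - D * (√(s / d) + s / d) * d := by
  have hd' : 0 < √d := Real.sqrt_pos.2 hd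
  have hd2 : √d * √d = d := Real.mul_self_sqrt hd.le
  have hs2 : √s * √s = s := Real.mul_self_sqrt hs
  have hs0 := Real.sqrt_nonneg s
  have e : D * (√(s / d) + s / d) * d = D * (√s * √d) + D * s := by
    rw [Real.sqrt_div hs]
    have : √s / √d * d = √s * √d := by
      rw [div_mul_eq_mul_div, div_eq_iff hd'.ne', mul_assoc, hd2]
    have h2 : s / d * d = s := div_mul_cancel₀ _ hd.ne'
    linear_combination D * this + D * h2
  have h1 : 2 * D * √s ≤ 2 * D * t := by gcongr
  have h2 : (√d - 2 * D * t) ^ 2 ≤ (√d - 2 * D * √s) ^ 2 := by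
    apply pow_le_pow_left₀ <;> linarith
  have h3 : √s ≤ √d := by nlinarith
  have h4 : 0 ≤ D * √s * (√d - 2 * D * √s) := mul_nonneg (by positivity) (by linarith)
  have h5 : 0 ≤ D * √s * (√d - √s) := mul_nonneg (by positivity) (by linarith)
  rw [e]
  nlinarith

theorem colouredBlock_mulVec_le {Z : Matrix (Fin n) (Fin p) ℝ} (hlam : ∀ j, 0 < lam j)
    (hU : U ∈ Matrix.orthogonalGroup (Fin p) ℝ) {C L q : ℝ} (hC : 0 ≤ C) (hq : 0 ≤ q)
    (hdev : ∀ x : Fin p → ℝ, |Z.mulVec x ⬝ᵥ Z.mulVec x - n * (x ⬝ᵥ x)| ≤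
      C * L ^ 2 * (√((p + q) / n) + (p + q) / n) * n * (x ⬝ᵥ x)) (x : Fin p → ℝ) :
    (colouredBlock Z lam U).mulVec x ⬝ᵥ (colouredBlock Z lam U).mulVec x ≤
      (n * sigmaMax (U * Matrix.diagonal lam * U.transpose)
        + ell C L q n (U * Matrix.diagonal lam * U.transpose)) * (x ⬝ᵥ x) := by
  rw [colouredBlock_mulVec]
  set v : Fin p → ℝ := fun a => √(lam a) * U.transpose.mulVec x a with hv
  have h1 := (abs_le.1 (hdev v)).2
  have h2 := sqrt_mul_dotProduct_self_le hlam hU (U.transpose.mulVec x)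
  rw [← hv, transpose_mulVec_dotProduct_self_of_orthogonal hU] at h2
  set ε := C * L ^ 2 * (√((p + q) / n) + (p + q) / n) with hε
  have hε0 : 0 ≤ ε := by positivity
  calc _ ≤ (n + ε * n) * (v ⬝ᵥ v) := by linarith
    _ ≤ (n + ε * n) * (_ * (x ⬝ᵥ x)) := by gcongr
    _ = _ := by rw [ell, ← hε]; ring

theorem le_colouredBlock_mulVec {Z : Matrix (Fin n) (Fin p) ℝ} (hlam : ∀ j, 0 < lam j)
    (hU : U ∈ Matrix.orthogonalGroup (Fin p) ℝ) {C L q : ℝ} (hC : 0 ≤ C) (hq : 0 ≤ q)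
    (hdev : ∀ x : Fin p → ℝ, |Z.mulVec x ⬝ᵥ Z.mulVec x - n * (x ⬝ᵥ x)| ≤
      C * L ^ 2 * (√((p + q) / n) + (p + q) / n) * n * (x ⬝ᵥ x)) (x : Fin p → ℝ) :
    (n * sigmaMin (U * Matrix.diagonal lam * U.transpose)
        - ell C L q n (U * Matrix.diagonal lam * U.transpose)) * (x ⬝ᵥ x) ≤
      (colouredBlock Z lam U).mulVec x ⬝ᵥ (colouredBlock Z lam U).mulVec x := by
  rw [colouredBlock_mulVec]
  set v : Fin p → ℝ := fun a => √(lam a) * U.transpose.mulVec x a with hv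
  have h1 := (abs_le.1 (hdev v)).1
  have h2 := sqrt_mul_dotProduct_self_le hlam hU (U.transpose.mulVec x)
  have h3 := le_sqrt_mul_dotProduct_self hlam hU (U.transpose.mulVec x)
  rw [← hv, transpose_mulVec_dotProduct_self_of_orthogonal hU] at h2 h3
  set ε := C * L ^ 2 * (√((p + q) / n) + (p + q) / n) with hε
  have hε0 : 0 ≤ ε := by positivity
  have h4 := mul_le_mul_of_nonneg_left h2 (by positivity : 0 ≤ ε * n)
  have h5 := mul_le_mul_of_nonneg_left h3 (Nat.cast_nonneg n : (0 : ℝ) ≤ n)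
  rw [ell, ← hε]
  nlinarith

theorem le_colouredBlock_transpose_mulVec {Z : Matrix (Fin n) (Fin p) ℝ} (hp : 0 < p)
    (hlam : ∀ j, 0 < lam j) (hU : U ∈ Matrix.orthogonalGroup (Fin p) ℝ) {D qbar : ℝ} (hD : 1 ≤ D)
    (hq : 0 ≤ qbar)
    (hdev : ∀ y : Fin n → ℝ,
      |Z.transpose.mulVec y ⬝ᵥ Z.transpose.mulVec y - p * (y ⬝ᵥ y)| ≤
        D * (√((n + qbar ^ 2) / p) + (n + qbar ^ 2) / p) * p * (y ⬝ᵥ y)) (y : Fin n → ℝ) :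
    sigmaMin (U * Matrix.diagonal lam * U.transpose) * (max 0 (√p - 2 * D * (√n + qbar))) ^ 2
        * (y ⬝ᵥ y) ≤
      (colouredBlock Z lam U).transpose.mulVec y ⬝ᵥ
        (colouredBlock Z lam U).transpose.mulVec y := by
  rw [colouredBlock_transpose_mulVec, mulVec_dotProduct_self_of_orthogonal hU]
  refine le_trans ?_ (le_sqrt_mul_dotProduct_self hlam hU (Z.transpose.mulVec y))
  rw [mul_assoc]
  refine mul_le_mul_of_nonneg_left ?_ (sigmaMin_nonneg _)
  have hy := dotProduct_self_nonneg_real y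
  rcases le_or_gt (√p) (2 * D * (√n + qbar)) with h | h
  · rw [max_eq_left (by linarith)]
    simpa using dotProduct_self_nonneg_real (Z.transpose.mulVec y)
  · rw [max_eq_right (by linarith)]
    have hs : √(n + qbar ^ 2) ≤ √n + qbar := by
      rw [Real.sqrt_le_left (by positivity)]
      nlinarith [Real.sq_sqrt (Nat.cast_nonneg n : (0 : ℝ) ≤ n), Real.sqrt_nonneg (n : ℝ)]
    have h1 := sqrt_sub_sq_le (by positivity) (Nat.cast_pos.2 hp : (0 : ℝ) < p) hD hs h
    have h2 := (abs_le.1 (hdev y)).1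
    have h3 := mul_le_mul_of_nonneg_right h1 hy
    linarith

end

/-! ### Covariance of the rows and sub-gaussian bounds for the entries -/

section
variable {Ω : Type*} [MeasurableSpace Ω] {μ : Measure Ω} {n p : ℕ}

/-- An infinite variance has default real value `0`, so variance one forces a finite second moment.
-/
theorem IsStdSubgaussian.memLp_two [IsFiniteMeasure μ] {z : Ω → ℝ} (h : IsStdSubgaussian z μ) :
    MemLp z 2 μ := by
  rw [← evariance_lt_top_iff_memLp h.measurable.aestronglyMeasurable, lt_top_iff_ne_top]
  intro ht
  have := h.variance_one
  simp [variance, ht] at this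

theorem covariance_colouredBlock [IsProbabilityMeasure μ]
    {Z : Ω → Matrix (Fin n) (Fin p) ℝ}
    (hZ : ∀ i j, IsStdSubgaussian (fun ω => Z ω i j) μ)
    (hind : iIndepFun (fun (x : Fin n × Fin p) ω => Z ω x.1 x.2) μ) {lam : Fin p → ℝ}
    (hlam : ∀ j, 0 < lam j) (U : Matrix (Fin p) (Fin p) ℝ) (i : Fin n) (j l : Fin p) :
    covariance (fun ω => colouredBlock (Z ω) lam U i j)
      (fun ω => colouredBlock (Z ω) lam U i l) μ
      = (U * Matrix.diagonal lam * U.transpose) j l := by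
  simp only [colouredBlock_apply]
  rw [covariance_fun_sum_fun_sum (fun a => (hZ i a).memLp_two.const_mul _)
    (fun a => (hZ i a).memLp_two.const_mul _), Matrix.mul_apply]
  refine Finset.sum_congr rfl fun a _ => ?_
  rw [Finset.sum_eq_single a]
  · rw [covariance_const_mul_left, covariance_const_mul_right,
      covariance_self (hZ i a).measurable.aemeasurable, (hZ i a).variance_one,
      Matrix.mul_diagonal, Matrix.transpose_apply]
    linear_combination U j a * U l a * Real.mul_self_sqrt (hlam a).le
  · intro b _ hb
    have : (fun ω => Z ω i a) ⟂ᵢ[μ] (fun ω => Z ω i b) :=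
      hind.indepFun (i := (i, a)) (j := (i, b)) (by simpa using hb.symm)
    rw [covariance_const_mul_left, covariance_const_mul_right,
      this.covariance_eq_zero (hZ i a).memLp_two (hZ i b).memLp_two]
    ring
  · simp

/-- Doubling `L` puts it strictly above the infimum, so no attainment argument is required. -/
theorem subgaussianBound_two_mul_of_psi2Norm_le {z : Ω → ℝ} (hz : IsSubgaussian z μ) {L : ℝ}
    (hL : 0 < L) (h : psi2Norm z μ ≤ L) : SubgaussianBound z μ (2 * L) := by
  obtain ⟨M, ⟨hM0, hM⟩, hML⟩ := exists_lt_of_csInf_lt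
    (s := {L : ℝ | 0 < L ∧ SubgaussianBound z μ L}) hz (h.trans_lt (by linarith : L < 2 * L))
  exact hM.mono hM0 hML.le

theorem subgaussianBound_entry {Z : Ω → Matrix (Fin n) (Fin p) ℝ}
    (hZ : ∀ i j, IsStdSubgaussian (fun ω => Z ω i j) μ) {lam : Fin p → ℝ}
    (hlam : ∀ j, 0 < lam j) {U : Matrix (Fin p) (Fin p) ℝ}
    (hU : U ∈ Matrix.orthogonalGroup (Fin p) ℝ) {L : ℝ} (hL : 1 ≤ L)
    (hpsi : ∀ i (h : Fin p → ℝ), psi2Norm (fun ω => h ⬝ᵥ colouredBlock (Z ω) lam U i) μ ≤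
      L * √(h ⬝ᵥ (U * Matrix.diagonal lam * U.transpose).mulVec h)) (i : Fin n) (j : Fin p) :
    SubgaussianBound (fun ω => Z ω i j) μ (2 * L) := by
  have hs : 0 < √(lam j) := Real.sqrt_pos.2 (hlam j)
  -- This direction undoes the colouring: `hᵀa` is the entry `Z i j`, and `hᵀΣh = 1`.
  set h : Fin p → ℝ := U.mulVec (Pi.single j (√(lam j))⁻¹) with hh
  have hUh : U.transpose.mulVec h = Pi.single j (√(lam j))⁻¹ := by
    rw [hh, Matrix.mulVec_mulVec, (Matrix.mem_orthogonalGroup_iff' _ _).1 hU, Matrix.one_mulVec]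
  have e1 : ∀ ω, h ⬝ᵥ colouredBlock (Z ω) lam U i = Z ω i j := by
    intro ω
    rw [dotProduct_comm]
    change (colouredBlock (Z ω) lam U).mulVec h i = _
    rw [colouredBlock_mulVec, hUh, Matrix.mulVec, dotProduct, Finset.sum_eq_single j]
    · simp [hs.ne']
    · intro a _ ha
      simp [ha]
    · simp
  have e2 : h ⬝ᵥ (U * Matrix.diagonal lam * U.transpose).mulVec h = 1 := by
    rw [Matrix.mul_assoc, ← Matrix.mulVec_mulVec, ← Matrix.mulVec_mulVec, hUh, dotProduct_comm,
      mulVec_dotProduct_eq, hUh, dotProduct_single, Matrix.mulVec_diagonal, Pi.single_eq_same]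
    field_simp
    exact (Real.sq_sqrt (hlam j).le).symm
  have := hpsi i h
  simp only [e1, e2, Real.sqrt_one, mul_one] at this
  exact subgaussianBound_two_mul_of_psi2Norm_le (hZ i j).subgaussian (by linarith) this
end

/-! ### Assembly of `betaS` and the union bound -/

theorem ofReal_one_add_sqrt_le_betaS {K n : ℕ} {p : Fin K → ℕ}
    {Sig : ∀ k, Matrix (Fin (p k)) (Fin (p k)) ℝ} {C : ℝ} {L q qbar : Fin K → ℝ}
    (hnum : ∀ k, 0 ≤ n * sigmaMax (Sig k) + ell C (L k) (q k) n (Sig k))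
    (heta : ∀ i k, i ≠ k → 0 < eta C (L i) (q i) (qbar i) n (Sig i)) :
    ENNReal.ofReal (1 + 1 / K * √(∑ i, ∑ k, if i = k then 1 else
      (n * sigmaMax (Sig k) + ell C (L k) (q k) n (Sig k)) /
        eta C (L i) (q i) (qbar i) n (Sig i))) ≤ betaS n Sig C L q qbar := by
  classical
  set f : Fin K → Fin K → ℝ := fun i k => (n * sigmaMax (Sig k) + ell C (L k) (q k) n (Sig k)) /
        eta C (L i) (q i) (qbar i) n (Sig i) with hf
  have hf0 : ∀ i k, 0 ≤ f i k := fun i k => div_nonneg (hnum k) (eta_nonneg _)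
  have e : ∑ i, ∑ k, (if i = k then 1 else f i k)
      = K + ∑ k, ∑ i ∈ Finset.univ.filter (fun i => i ≠ k), f i k := by
    rw [Finset.sum_comm]
    have : ∀ k, ∑ i, (if i = k then 1 else f i k)
        = 1 + ∑ i ∈ Finset.univ.filter (fun i => i ≠ k), f i k := by
      intro k
      rw [Finset.sum_ite, Finset.filter_eq' _ k]
      simp
    simp only [this, Finset.sum_add_distrib]
    simp
  have hS0 : 0 ≤ ∑ k, ∑ i ∈ Finset.univ.filter (fun i => i ≠ k), f i k :=
    Finset.sum_nonneg fun k _ => Finset.sum_nonneg fun i _ => hf0 i k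
  have e2 : ENNReal.ofReal (∑ k, ∑ i ∈ Finset.univ.filter (fun i => i ≠ k), f i k)
      = ∑ k, ∑ i ∈ Finset.univ.filter (fun i => i ≠ k),
      ENNReal.ofReal (n * sigmaMax (Sig k) + ell C (L k) (q k) n (Sig k)) /
        ENNReal.ofReal (eta C (L i) (q i) (qbar i) n (Sig i)) := by
    rw [ENNReal.ofReal_sum_of_nonneg fun k _ => Finset.sum_nonneg fun i _ => hf0 i k]
    refine Finset.sum_congr rfl fun k _ => ?_
    rw [ENNReal.ofReal_sum_of_nonneg fun i _ => hf0 i k]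
    refine Finset.sum_congr rfl fun i hi => ?_
    rw [hf, ENNReal.ofReal_div_of_pos (heta i k (Finset.mem_filter.1 hi).2)]
  rw [e, betaS, ← e2, ← ENNReal.ofReal_natCast K, ← ENNReal.ofReal_add (Nat.cast_nonneg K) hS0,
    ENNReal.ofReal_rpow_of_nonneg (add_nonneg (Nat.cast_nonneg K) hS0) (by norm_num),
    ← Real.sqrt_eq_rpow, ← ENNReal.ofReal_mul (by positivity), ← ENNReal.ofReal_one,
    ← ENNReal.ofReal_add zero_le_one (by positivity)]

theorem betaS_eq_top {K n : ℕ} {p : Fin K → ℕ}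
    {Sig : ∀ k, Matrix (Fin (p k)) (Fin (p k)) ℝ} {C : ℝ} {L q qbar : Fin K → ℝ} {i k : Fin K}
    (hik : i ≠ k) (hnum : 0 < n * sigmaMax (Sig k) + ell C (L k) (q k) n (Sig k))
    (heta : eta C (L i) (q i) (qbar i) n (Sig i) ≤ 0) : betaS n Sig C L q qbar = ⊤ := by
  have hK : 0 < K := i.pos
  have h1 : ENNReal.ofReal (n * sigmaMax (Sig k) + ell C (L k) (q k) n (Sig k)) /
        ENNReal.ofReal (eta C (L i) (q i) (qbar i) n (Sig i)) = ⊤ := by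
    rw [ENNReal.ofReal_of_nonpos heta, ENNReal.div_zero (ENNReal.ofReal_pos.2 hnum).ne']
  have h2 : (∑ k, ∑ i ∈ Finset.univ.filter (fun i => i ≠ k),
      ENNReal.ofReal (n * sigmaMax (Sig k) + ell C (L k) (q k) n (Sig k)) /
        ENNReal.ofReal (eta C (L i) (q i) (qbar i) n (Sig i))) = ⊤ :=
    ENNReal.sum_eq_top.2 ⟨k, Finset.mem_univ _, ENNReal.sum_eq_top.2 ⟨i, by simpa using hik, h1⟩⟩
  rw [betaS, h2, add_top, ENNReal.top_rpow_of_pos (by norm_num),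
    ENNReal.mul_top (ENNReal.ofReal_pos.2 (by positivity)).ne', add_top]

theorem spectralNorm_iterMatrix_le_betaS {K n : ℕ} (hn : 0 < n) {p : Fin K → ℕ}
    {A : ∀ k, Matrix (Fin n) (Fin (p k)) ℝ}
    {Sig : ∀ k, Matrix (Fin (p k)) (Fin (p k)) ℝ} {C : ℝ} {L q qbar : Fin K → ℝ} (hC : 0 ≤ C)
    (hq : ∀ k, 0 ≤ q k) (hSig : ∀ k, 0 < sigmaMax (Sig k))
    (hup : ∀ k x, (A k).mulVec x ⬝ᵥ (A k).mulVec x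
      ≤ (n * sigmaMax (Sig k) + ell C (L k) (q k) n (Sig k)) * (x ⬝ᵥ x))
    (hlow : ∀ i y, eta C (L i) (q i) (qbar i) n (Sig i)
      * ((pinv (A i)).mulVec y ⬝ᵥ (pinv (A i)).mulVec y) ≤ y ⬝ᵥ y) :
    ENNReal.ofReal (spectralNorm (iterMatrix A)) ≤ betaS n Sig C L q qbar := by
  have hnum : ∀ k, 0 < n * sigmaMax (Sig k) + ell C (L k) (q k) n (Sig k) := fun k =>
    add_pos_of_pos_of_nonneg (mul_pos (Nat.cast_pos.2 hn) (hSig k)) (ell_nonneg hC (hq k) _)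
  -- A vanishing `η` with a partner block makes `betaS` infinite, so the claim is trivial. For `K =
  -- 1` no such pair exists, and `η` does not enter.
  by_cases hbad : ∃ i k, i ≠ k ∧ eta C (L i) (q i) (qbar i) n (Sig i) ≤ 0
  · obtain ⟨i, k, hik, h⟩ := hbad
    rw [betaS_eq_top hik (hnum k) h]
    exact le_top
  push Not at hbad
  refine le_trans (ENNReal.ofReal_le_ofReal (spectralNorm_iterMatrix_le A ?_ ?_))
    (ofReal_one_add_sqrt_le_betaS (fun k => (hnum k).le) hbad)
  · intro i k
    split_ifs with h
    · exact one_pos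
    · exact div_pos (hnum k) (hbad i k h)
  · intro i k x
    split_ifs with h
    · subst h
      rw [one_mul]
      exact pinv_mul_self_mulVec_le (A i) x
    · rw [div_mul_eq_mul_div, le_div_iff₀' (hbad i k h), ← Matrix.mulVec_mulVec]
      exact (hlow i _).trans (hup k x)

theorem eta_mul_pinv_mulVec_le {n p : ℕ} (hp : 0 < p) {Z : Matrix (Fin n) (Fin p) ℝ}
    {lam : Fin p → ℝ} {U : Matrix (Fin p) (Fin p) ℝ} (hlam : ∀ j, 0 < lam j)
    (hU : U ∈ Matrix.orthogonalGroup (Fin p) ℝ) {C L q qbar : ℝ} (hC : 1 ≤ C) (hL : 1 ≤ L)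
    (hq : 0 ≤ q) (hqbar : 0 ≤ qbar)
    (hdev : ∀ x : Fin p → ℝ, |Z.mulVec x ⬝ᵥ Z.mulVec x - n * (x ⬝ᵥ x)| ≤
      2 * C * L ^ 2 * (√((p + q) / n) + (p + q) / n) * n * (x ⬝ᵥ x))
    (hdevT : n < p → ∀ y : Fin n → ℝ,
      |Z.transpose.mulVec y ⬝ᵥ Z.transpose.mulVec y - p * (y ⬝ᵥ y)| ≤
        C * L ^ 2 * (√((n + qbar ^ 2) / p) + (n + qbar ^ 2) / p) * p * (y ⬝ᵥ y))
    (y : Fin n → ℝ) :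
    eta (2 * C) L q qbar n (U * Matrix.diagonal lam * U.transpose)
      * ((pinv (colouredBlock Z lam U)).mulVec y ⬝ᵥ (pinv (colouredBlock Z lam U)).mulVec y)
      ≤ y ⬝ᵥ y := by
  unfold eta
  split_ifs with h
  · refine pinv_mulVec_le_of_lower_bound (fun x => ?_) y
    rw [max_mul_of_nonneg _ _ (dotProduct_self_nonneg_real x), zero_mul]
    exact max_le (dotProduct_self_nonneg_real _)
      (le_colouredBlock_mulVec hlam hU (by linarith) hq hdev x)
  · refine pinv_mulVec_le_of_transpose_lower_bound (fun w => ?_) y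
    have := le_colouredBlock_transpose_mulVec hp hlam hU (D := C * L ^ 2) (by nlinarith) hqbar
      (hdevT (not_le.1 h)) w
    rwa [← mul_assoc 2 C] at this

end PartitionedLS

theorem theorem3 :
    ∃ C : ℝ, 0 < C ∧
      ∀ (Ω : Type*) [MeasurableSpace Ω] (μ : MeasureTheory.Measure Ω)
        [MeasureTheory.IsProbabilityMeasure μ]
        (K n : ℕ) (_hK : 0 < K) (_hn : 0 < n)
        (p : Fin K → ℕ) (_hp : ∀ k, 0 < p k)
        -- the matrices `Z_k`: all entries independent, i.i.d. `S(1)` inside each block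
        (Z : ∀ k, Ω → Matrix (Fin n) (Fin (p k)) ℝ)
        (_hZ : ∀ k i j, PartitionedLS.IsStdSubgaussian (fun ω => Z k ω i j) μ)
        (_hident : ∀ k i j i' j', ProbabilityTheory.IdentDistrib
          (fun ω => Z k ω i j) (fun ω => Z k ω i' j') μ μ)
        (_hindep : ProbabilityTheory.iIndepFun
          (fun (x : Σ k, Fin n × Fin (p k)) (ω : Ω) => Z x.1 ω x.2.1 x.2.2) μ)
        -- `Λ_k = diag(lam k)` is positive definite and `U_k` is orthogonal
        (lam : ∀ k, Fin (p k) → ℝ) (_hlam : ∀ k j, 0 < lam k j)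
        (U : ∀ k, Matrix (Fin (p k)) (Fin (p k)) ℝ)
        (_hU : ∀ k, U k ∈ Matrix.orthogonalGroup (Fin (p k)) ℝ)
        -- the blocks `A_k = Z_k Λ_k^{1/2} U_kᵀ`
        (A : ∀ k, Ω → Matrix (Fin n) (Fin (p k)) ℝ)
        (_hA : ∀ k ω, A k ω = PartitionedLS.colouredBlock (Z k ω) (lam k) (U k))
        -- `Σ_k` is the covariance matrix of the rows of `A_k`
        (Sig : ∀ k, Matrix (Fin (p k)) (Fin (p k)) ℝ)
        (_hSig : ∀ k i j l, Sig k j l =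
          ProbabilityTheory.covariance (fun ω => A k ω i j) (fun ω => A k ω i l) μ)
        -- the constants `L_k`
        (L : Fin K → ℝ) (_hL : ∀ k, 1 ≤ L k)
        (_hpsi : ∀ k i (h : Fin (p k) → ℝ),
          PartitionedLS.psi2Norm (fun ω => h ⬝ᵥ A k ω i) μ ≤
            L k * √(h ⬝ᵥ (Sig k).mulVec h))
        (q qbar : Fin K → ℝ) (_hq : ∀ k, 0 ≤ q k) (_hqbar : ∀ k, 0 ≤ qbar k),
        1 - ∑ k, 2 * Real.exp (-(q k))
            - ∑ k ∈ Finset.univ.filter (fun k => n < p k), 2 * Real.exp (-(qbar k) ^ 2) ≤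
          μ.real {ω | ENNReal.ofReal
              (PartitionedLS.spectralNorm (PartitionedLS.iterMatrix (fun k => A k ω))) ≤
            PartitionedLS.betaS n Sig C L q qbar} := by
  -- For entries with bound `M` the variance proxy is `2M²`, Bernstein gives `48 · 2M² = 96M²`, and
  -- the net factor `100/3` makes it `3200M²`. With `M = 2L` this is `12800L²`; the last factor 2
  -- comes from `sqrt_sub_sq_le`.
  refine ⟨2 * 12800, by norm_num, ?_⟩
  intro Ω _ μ _ K n hK hn p hp Z hZ _ hindep lam hlam U hU A hA Sig hSig L hL hpsi q qbar hq hqbar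
  have hind : ∀ k, ProbabilityTheory.iIndepFun
      (fun (x : Fin n × Fin (p k)) ω => Z k ω x.1 x.2) μ := fun k =>
    hindep.precomp (g := fun x : Fin n × Fin (p k) => (⟨k, x⟩ : Σ k, Fin n × Fin (p k)))
      fun a b h => by simpa using h
  have hindT : ∀ k, ProbabilityTheory.iIndepFun
      (fun (x : Fin (p k) × Fin n) ω => (Z k ω).transpose x.1 x.2) μ := fun k =>
    (hind k).precomp (g := Prod.swap) Prod.swap_injective
  have hSig' : ∀ k, Sig k = U k * Matrix.diagonal (lam k) * (U k).transpose := by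
    intro k
    ext j l
    rw [hSig k ⟨0, hn⟩ j l]
    simp only [hA]
    exact PartitionedLS.covariance_colouredBlock (hZ k) (hind k) (hlam k) (U k) _ j l
  have hsub : ∀ k i j, PartitionedLS.SubgaussianBound (fun ω => Z k ω i j) μ (2 * L k) := by
    intro k
    refine PartitionedLS.subgaussianBound_entry (hZ k) (hlam k) (hU k) (hL k) fun i h => ?_
    have := hpsi k i h
    rw [hSig' k] at this
    simpa only [hA] using this
  have : Nonempty (Fin n) := ⟨⟨0, hn⟩⟩
  have : ∀ k, Nonempty (Fin (p k)) := fun k => ⟨⟨0, hp k⟩⟩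
  let bad : Fin K → Set Ω := fun k => {ω | ¬ ∀ x : Fin (p k) → ℝ,
    |(Z k ω).mulVec x ⬝ᵥ (Z k ω).mulVec x - n * (x ⬝ᵥ x)| ≤
      12800 * L k ^ 2 * (√((p k + q k) / n) + (p k + q k) / n) * n * (x ⬝ᵥ x)}
  let badT : Fin K → Set Ω := fun k => {ω | ¬ ∀ y : Fin n → ℝ,
    |(Z k ω).transpose.mulVec y ⬝ᵥ (Z k ω).transpose.mulVec y - p k * (y ⬝ᵥ y)| ≤
      12800 * L k ^ 2 * (√((n + qbar k ^ 2) / p k) + (n + qbar k ^ 2) / p k) * p k * (y ⬝ᵥ y)}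
  have hbad : ∀ k, μ.real (bad k) ≤ 2 * Real.exp (-(q k)) := by
    intro k
    have h := PartitionedLS.measure_exists_mulVec_sq_deviation_le (Z := Z k)
      (fun i j => (hZ k i j).measurable) (M := 2 * L k) (by linarith [hL k]) (hsub k)
      (fun i j => (hZ k i j).mean_zero) (fun i j => (hZ k i j).variance_one) (hind k) (hq k)
    simp only [Fintype.card_fin] at h
    rwa [show 3200 * (2 * L k) ^ 2 = 12800 * L k ^ 2 by ring] at h
  have hbadT : ∀ k, μ.real (badT k) ≤ 2 * Real.exp (-(qbar k) ^ 2) := by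
    intro k
    have h := PartitionedLS.measure_exists_mulVec_sq_deviation_le
      (Z := fun ω => (Z k ω).transpose)
      (fun i j => (hZ k j i).measurable) (M := 2 * L k) (by linarith [hL k])
      (fun i j => hsub k j i) (fun i j => (hZ k j i).mean_zero)
      (fun i j => (hZ k j i).variance_one) (hindT k) (sq_nonneg (qbar k))
    simp only [Fintype.card_fin] at h
    rwa [show 3200 * (2 * L k) ^ 2 = 12800 * L k ^ 2 by ring] at h
  set T : Finset (Fin K) := Finset.univ.filter (fun k => n < p k) with hT
  set good : Set Ω := {ω | ENNReal.ofReal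
      (PartitionedLS.spectralNorm (PartitionedLS.iterMatrix (fun k => A k ω))) ≤
    PartitionedLS.betaS n Sig (2 * 12800) L q qbar} with hgood
  -- Covering the whole space, rather than passing to complements, needs only monotonicity and
  -- subadditivity, so measurability of these events plays no role.
  have hcover : (Set.univ : Set Ω) ⊆ (good ∪ ⋃ k ∈ Finset.univ, bad k) ∪ ⋃ k ∈ T, badT k := by
    intro ω _
    by_contra hω
    simp only [Set.mem_union, Set.mem_iUnion, not_or, not_exists] at hω
    obtain ⟨⟨hg, hb⟩, hbT⟩ := hω
    have hb' : ∀ k (x : Fin (p k) → ℝ),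
        |(Z k ω).mulVec x ⬝ᵥ (Z k ω).mulVec x - n * (x ⬝ᵥ x)| ≤
          2 * 12800 * L k ^ 2 * (√((p k + q k) / n) + (p k + q k) / n) * n * (x ⬝ᵥ x) := by
      intro k x
      refine (not_not.1 (hb k (Finset.mem_univ k)) x).trans ?_
      have := hq k
      have := PartitionedLS.dotProduct_self_nonneg_real x
      gcongr
      norm_num
    refine hg (PartitionedLS.spectralNorm_iterMatrix_le_betaS hn (by norm_num) hq ?_ ?_ ?_)
    · intro k
      rw [hSig' k]
      exact (hlam k ⟨0, hp k⟩).trans_le (PartitionedLS.le_sigmaMax (hlam k) (hU k) _)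
    · intro k x
      simp only [hA]
      rw [hSig' k]
      exact PartitionedLS.colouredBlock_mulVec_le (hlam k) (hU k) (by norm_num) (hq k) (hb' k) x
    · intro k y
      simp only [hA]
      rw [hSig' k]
      exact PartitionedLS.eta_mul_pinv_mulVec_le (hp k) (hlam k) (hU k) (by norm_num) (hL k)
        (hq k) (hqbar k) (hb' k) (fun h => not_not.1 (hbT k (by simpa [hT] using h))) y
  have htotal : (1 : ℝ) ≤ μ.real good + ∑ k, 2 * Real.exp (-(q k))
      + ∑ k ∈ T, 2 * Real.exp (-(qbar k) ^ 2) := by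
    calc (1 : ℝ) = μ.real Set.univ := by simp
      _ ≤ μ.real ((good ∪ ⋃ k ∈ Finset.univ, bad k) ∪ ⋃ k ∈ T, badT k) :=
          MeasureTheory.measureReal_mono hcover (MeasureTheory.measure_ne_top _ _)
      _ ≤ μ.real good + μ.real (⋃ k ∈ Finset.univ, bad k) + μ.real (⋃ k ∈ T, badT k) :=
          (MeasureTheory.measureReal_union_le _ _).trans
            (by gcongr; exact MeasureTheory.measureReal_union_le _ _)
      _ ≤ _ := by
          gcongr
          · exact (MeasureTheory.measureReal_biUnion_finset_le _ _).trans
              (Finset.sum_le_sum fun k _ => hbad k)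
          · exact (MeasureTheory.measureReal_biUnion_finset_le _ _).trans
              (Finset.sum_le_sum fun k _ => hbadT k)
  linarith
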